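/- Fix $N\ge 1$ and write $[N]=\{0,\dots,N-1\}$. Element distinctness on $N$ items: given oracle access to $f:[N]\to[N]$, decide whether there are $x\ne y$ with $f(x)=f(y)$. One query is the phase oracle $O_f|i,b\rangle=e^{2\pi \mathrm{i}\, b f(i)/N}|i,b\rangle$, $i,b\in[N]$. A PDQP query algorithm is a circuit on the query register and a finite workspace, started in a computational basis state, with steps $t=1,2,\dots,T$. Step $t$ applies an input-independent unitary $U_t$ and then a (possibly trivial) collapsing partial measurement $M_t$ in the computational basis. After that it either applies the oracle or takes a non-collapsing measurement, that is, it samples the current state in the computational basis while the computation continues with the undisturbed state. In the end a deterministic classical rule decides from the list of all samples. Let $Q$ be the number of steps with a query and $P$ the number of steps with a non-collapsing measurement; the complexity is $Q+P$. In the non-adaptive version, the $Q$ queries are made in a single parallel round, $|i_1,b_1,\dots,i_Q,b_Q\rangle\mapsto e^{2\pi \mathrm{i}\sum_j b_j f(i_j)/N}|i_1,b_1,\dots,i_Q,b_Q\rangle$, applied to an input-independent state $U_0|0\rangle$ and followed by $P$ steps each consisting of a unitary, a collapsing partial measurement and a non-collapsing measurement. An algorithm solves the problem on a set of inputs if on each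 of them it errs with probability at most $1/3$. Call $f$ almost injective if exactly one unordered pair $\{x,x'\}$ with $x\ne x'$ satisfies $f(x)=f(x')$. Then: 1. There is a constant $c>0$ such that for all $N\ge2$ every PDQP query algorithm that solves element distinctness, even only on the injective and the almost injective functions, has $Q+P\ge c\,N^{1/4}$. 2. There is a constant $C$ such that for all $N\ge1$ some PDQP query algorithm solves element distinctness on all inputs with $Q+P\le C\sqrt N$. 3. With non-adaptive queries the complexity is $\tilde\Theta(\sqrt N)$: there is a constant $c>0$ such that for all $N\ge2$ every non-adaptive PDQP query algorithm that solves element distinctness, even only on the injective and the almost injective functions, has $Q+P\ge c\sqrt N$; and there are constants $C,k$ such that for all $N\ge2$ some non-adaptive PDQP query algorithm solves element distinctness on all inputs with $Q+P\le C\sqrt N(\log N)^k$. -/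

import Mathlib

/-! Quantum query algorithms with non-collapsing measurements. Pure states are vectors
`B → ℂ` of amplitudes with respect to a finite computational basis `B`. -/

/-- One step of a circuit, apart from its query or its non-collapsing measurement: a unitary `U`
followed by a collapsing partial measurement of the value of `label` on the computational basis.
(Measuring a subregister is the case in which `label` reads off that subregister; a constant
`label` means that nothing is measured.) -/
structure Gate (B Out : Type) [Fintype B] [DecidableEq B] where
  U : Matrix.unitaryGroup B ℂ
  label : B → Out

namespace Gate

variable {B Out : Type} [Fintype B] [DecidableEq B] [DecidableEq Out]

/-- The state after the unitary and before the collapsing measurement. -/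
noncomputable def evolve (g : Gate B Out) (φ : B → ℂ) : B → ℂ :=
  Matrix.mulVec (g.U : Matrix B B ℂ) φ

/-- Probability that the collapsing measurement returns `k`. -/
noncomputable def prob (g : Gate B Out) (φ : B → ℂ) (k : Out) : ℝ :=
  ∑ a, if g.label a = k then ‖g.evolve φ a‖ ^ 2 else 0

/-- Normalized state after the collapsing measurement has returned `k`
(it is only used with weight `prob g φ k`, so its value for `prob g φ k = 0` is irrelevant). -/
noncomputable def post (g : Gate B Out) (φ : B → ℂ) (k : Out) : B → ℂ :=
  fun a => if g.label a = k then g.evolve φ a / (Real.sqrt (g.prob φ k) : ℂ) else 0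

end Gate

/-- Acceptance probability of a circuit that is started in the state `φ`. The query oracle is
the diagonal operator `|a⟩ ↦ phase a • |a⟩`. A step `(g, true)` applies `g` and then the oracle.
A step `(g, false)` applies `g` and then takes a non-collapsing measurement: a sample of the
current state in the computational basis, after which the computation continues with the
undisturbed state. At the end the list of all the samples, in chronological order, is given
to the classical predicate `dec`. -/
noncomputable def acceptProb {B Out : Type} [Fintype B] [DecidableEq B] [Fintype Out]
    [DecidableEq Out] (phase : B → ℂ) :
    List (Gate B Out × Bool) → (List B → Bool) → (B → ℂ) → ℝ
  | [], dec, _ => if dec [] = true then 1 else 0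
  | (g, true) :: rest, dec, φ =>
      ∑ k, g.prob φ k * acceptProb phase rest dec (fun a => phase a * g.post φ k a)
  | (g, false) :: rest, dec, φ =>
      ∑ k, g.prob φ k *
        ∑ a, ‖g.post φ k a‖ ^ 2 * acceptProb phase rest (fun v => dec (a :: v)) (g.post φ k)

/-- The phase oracle of `f : [N] → [N]` on one query register:
`|i, b⟩ ↦ exp (2πi · b · f(i) / N) |i, b⟩`. For two values this is the sign `(-1) ^ (b · f(i))`. -/
noncomputable def queryPhase {N : ℕ} (f : Fin N → Fin N) (r : Fin N × Fin N) : ℂ :=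
  Complex.exp (2 * Real.pi * Complex.I * ((r.2 : ℕ) : ℂ) * ((f r.1 : ℕ) : ℂ) / (N : ℂ))

/-- A PDQP query algorithm for inputs `f : [N] → [N]`: a circuit on a query register `|i, b⟩` and
a finite workspace `W`, started in a computational basis state, with a classical decision rule
for the list of samples. -/
structure PDQPAlgorithm (N : ℕ) where
  W : Type
  Out : Type
  [fintypeW : Fintype W]
  [decidableEqW : DecidableEq W]
  [fintypeOut : Fintype Out]
  [decidableEqOut : DecidableEq Out]
  init : (Fin N × Fin N) × W
  steps : List (Gate ((Fin N × Fin N) × W) Out × Bool)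
  dec : List ((Fin N × Fin N) × W) → Bool

namespace PDQPAlgorithm

attribute [instance] fintypeW decidableEqW fintypeOut decidableEqOut

variable {N : ℕ}

/-- Number of queries: the steps that perform a query. -/
def queries (A : PDQPAlgorithm N) : ℕ := A.steps.countP (fun s => s.2)

/-- Number of non-collapsing measurements: the steps that do not perform a query. -/
def samples (A : PDQPAlgorithm N) : ℕ := A.steps.countP (fun s => !s.2)

/-- Probability that the algorithm answers "yes" on input `f`. -/
noncomputable def accept (A : PDQPAlgorithm N) (f : Fin N → Fin N) : ℝ :=
  acceptProb (fun a => queryPhase f a.1) A.steps A.dec (Pi.single A.init 1)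

end PDQPAlgorithm

/-- A PDQP query algorithm with non-adaptive queries: after the unitary `U₀`, a single round of
`queries` parallel queries is made, on the registers `|i₁, b₁, …, i_Q, b_Q⟩`; all the other
steps (unitary, collapsing measurement, non-collapsing measurement) come after it. -/
structure NonadaptivePDQPAlgorithm (N : ℕ) where
  queries : ℕ
  W : Type
  Out : Type
  [fintypeW : Fintype W]
  [decidableEqW : DecidableEq W]
  [fintypeOut : Fintype Out]
  [decidableEqOut : DecidableEq Out]
  init : (Fin queries → Fin N × Fin N) × W
  U₀ : Matrix.unitaryGroup ((Fin queries → Fin N × Fin N) × W) ℂ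
  steps : List (Gate ((Fin queries → Fin N × Fin N) × W) Out)
  dec : List ((Fin queries → Fin N × Fin N) × W) → Bool

namespace NonadaptivePDQPAlgorithm

attribute [instance] fintypeW decidableEqW fintypeOut decidableEqOut

variable {N : ℕ}

/-- Number of non-collapsing measurements: one after each step that follows the queries. -/
def samples (A : NonadaptivePDQPAlgorithm N) : ℕ := A.steps.length

/-- The parallel query `|i₁, b₁, …⟩ ↦ ∏ⱼ exp (2πi · bⱼ · f(iⱼ) / N) |i₁, b₁, …⟩`. -/
noncomputable def phase (A : NonadaptivePDQPAlgorithm N) (f : Fin N → Fin N)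
    (a : (Fin A.queries → Fin N × Fin N) × A.W) : ℂ :=
  ∏ j, queryPhase f (a.1 j)

/-- Probability that the algorithm answers "yes" on input `f`. -/
noncomputable def accept (A : NonadaptivePDQPAlgorithm N) (f : Fin N → Fin N) : ℝ :=
  acceptProb (A.phase f) (A.steps.map (fun g => (g, false))) A.dec
    (fun a => A.phase f a *
      Matrix.mulVec (A.U₀ : Matrix _ _ ℂ) (Pi.single A.init 1) a)

end NonadaptivePDQPAlgorithm

/-- The yes-instances of element distinctness. -/
def HasCollision {N : ℕ} (f : Fin N → Fin N) : Prop := ∃ x y, x ≠ y ∧ f x = f y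

/-- Exactly one unordered pair of distinct inputs has the same image. -/
def AlmostInjective {N : ℕ} (f : Fin N → Fin N) : Prop :=
  ∃ x y, x ≠ y ∧ f x = f y ∧
    ∀ u v, u ≠ v → f u = f v → (u = x ∧ v = y) ∨ (u = y ∧ v = x)

/-- `accept` is the acceptance probability of a procedure that decides element distinctness with
error probability at most `1/3` on every input in `D`. -/
def DecidesDistinctnessOn {N : ℕ} (D : Set (Fin N → Fin N)) (accept : (Fin N → Fin N) → ℝ) :
    Prop :=
  ∀ f ∈ D, (HasCollision f → 2 / 3 ≤ accept f) ∧ (¬ HasCollision f → accept f ≤ 1 / 3)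

/-! ### Squared norms of amplitude vectors -/

/-! Lower bounds. Compare the run on the identity with the run on `Function.update id x z`, where `z
= 0` is fixed and `x` ranges over the other positions. Collapsing outcomes and samples together form
one classical random record, and the Bhattacharyya coefficient (`affinity`) of the two records
cannot drop when the record is reduced to a yes/no answer (`affinity_le_accept`). A collapsing
measurement splits each state linearly into orthogonal branches, so when equal outcomes are paired,
the squared distances of the unnormalized branches add up to the squared distance before the
measurement. Each non-collapsing measurement costs the affinity at most half of the current squared
distance (`affinity_ge`). Hence a constant gap in acceptance forces the squared distances, summed
over all sample times and the end, to be at least a constant (`runDist_ge`).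

This sum is at most `P + 1` times a bound on a single distance, which comes from a hybrid argument:
queries create distance only through the weight of the identity run on position `x`. Weighted Young
gives a bound of order `Q` times that weight (`runDist_le`). Summed over `x`, the weights are at
most `4 * Q` (`sum_queryWeight_le`), so `N` is at most of order `P * Q ^ 2`. In the non-adaptive
model all the distance arises in the single round and is at most `4 * Q` in total over `x`, so `N`
is at most of order `P * Q`.

Upper bounds. Cover the positions by about `√N` blocks of size about `√N`, give each block a
register in uniform superposition, query each register once, and turn phases into values by an
inverse Fourier transform. Every register then holds a uniform pair `(i, f i)` from its block.
Non-collapsing measurements yield independent samples of this one state, so of order `√N` of them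
show both ends of a given collision with constant probability, and a false collision is never seen.
Sequential queries prepare the same state by swapping the registers through the query register. -/

theorem phase_smul {B : Type} (O : B → ℂ) (c : ℂ) (φ : B → ℂ) :
    (fun a => O a * (c • φ) a) = c • fun a => O a * φ a := by
  ext a; simp only [Pi.smul_apply, smul_eq_mul]; ring

section Vectors

variable {B : Type} [Fintype B]

/-- Squared `ℓ²` norm of a vector of amplitudes. -/
noncomputable def normSqSum (φ : B → ℂ) : ℝ := ∑ a, ‖φ a‖ ^ 2

/-- Inner product of the moduli of two vectors of amplitudes. -/
noncomputable def absInner (φ ψ : B → ℂ) : ℝ := ∑ a, ‖φ a‖ * ‖ψ a‖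

theorem normSqSum_nonneg (φ : B → ℂ) : 0 ≤ normSqSum φ :=
  Finset.sum_nonneg fun _ _ => by positivity

theorem absInner_nonneg (φ ψ : B → ℂ) : 0 ≤ absInner φ ψ :=
  Finset.sum_nonneg fun _ _ => by positivity

theorem absInner_le (φ ψ : B → ℂ) :
    absInner φ ψ ≤ √(normSqSum φ) * √(normSqSum ψ) :=
  Real.sum_mul_le_sqrt_mul_sqrt _ _ _

/-- Reverse triangle inequality entry by entry: the vectors of moduli are no farther apart than the
vectors themselves. The moduli are what computational-basis samples see. -/
theorem normSqSum_sub_ge (φ ψ : B → ℂ) :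
    normSqSum φ + normSqSum ψ - 2 * absInner φ ψ ≤ normSqSum (φ - ψ) := by
  unfold normSqSum absInner
  rw [← Finset.sum_add_distrib, Finset.mul_sum, ← Finset.sum_sub_distrib]
  refine Finset.sum_le_sum fun a _ => ?_
  have h := abs_norm_sub_norm_le (φ a) (ψ a)
  have h2 := pow_le_pow_left₀ (abs_nonneg _) h 2
  rw [sq_abs] at h2
  simp only [Pi.sub_apply]
  nlinarith

theorem normSqSum_smul (c : ℝ) (φ : B → ℂ) :
    normSqSum ((c : ℂ) • φ) = c ^ 2 * normSqSum φ := by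
  simp [normSqSum, Finset.mul_sum, mul_pow]

theorem sqrt_normSqSum_smul {c : ℝ} (hc : 0 ≤ c) (φ : B → ℂ) :
    √(normSqSum ((c : ℂ) • φ)) = c * √(normSqSum φ) := by
  rw [normSqSum_smul, Real.sqrt_mul (sq_nonneg c), Real.sqrt_sq hc]

theorem absInner_smul {c d : ℝ} (hc : 0 ≤ c) (hd : 0 ≤ d) (φ ψ : B → ℂ) :
    absInner ((c : ℂ) • φ) ((d : ℂ) • ψ) = c * d * absInner φ ψ := by
  simp only [absInner, Finset.mul_sum, Pi.smul_apply, smul_eq_mul, norm_mul,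
    Complex.norm_real, Real.norm_of_nonneg hc, Real.norm_of_nonneg hd]
  exact Finset.sum_congr rfl fun a _ => by ring

theorem normSqSum_phase {O : B → ℂ} (hO : ∀ a, ‖O a‖ = 1) (φ : B → ℂ) :
    normSqSum (fun a => O a * φ a) = normSqSum φ := by
  simp [normSqSum, hO]

theorem normSqSum_mulVec_unitary [DecidableEq B] (U : Matrix.unitaryGroup B ℂ) (φ : B → ℂ) :
    normSqSum (Matrix.mulVec (U : Matrix B B ℂ) φ) = normSqSum φ := by
  have key : ∀ ψ : B → ℂ, ((normSqSum ψ : ℝ) : ℂ) = dotProduct (star ψ) ψ := fun ψ => by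
    simp only [normSqSum, dotProduct, Complex.ofReal_sum, Pi.star_apply, Complex.ofReal_pow]
    exact Finset.sum_congr rfl fun a _ => (Complex.conj_mul' (ψ a)).symm
  have h : ((normSqSum (Matrix.mulVec (U : Matrix B B ℂ) φ) : ℝ) : ℂ) = (normSqSum φ : ℝ) := by
    rw [key, key, Matrix.star_mulVec, ← Matrix.dotProduct_mulVec, Matrix.mulVec_mulVec,
      ← Matrix.star_eq_conjTranspose, Matrix.UnitaryGroup.star_mul_self, Matrix.one_mulVec]
  exact_mod_cast h

theorem normSqSum_single [DecidableEq B] (b : B) : normSqSum (Pi.single b (1 : ℂ)) = 1 := by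
  rw [normSqSum, Finset.sum_eq_single b] <;> simp +contextual

/-- Weighted Young inequality for one oracle call on two states under two oracles. -/
theorem normSqSum_phase_sub_le {O O' : B → ℂ} (hO' : ∀ a, ‖O' a‖ = 1) {ε : ℝ} (hε : 0 < ε)
    (φ ψ : B → ℂ) :
    normSqSum ((fun a => O a * φ a) - fun a => O' a * ψ a) ≤
      (1 + ε) * normSqSum (φ - ψ) + (1 + ε⁻¹) * normSqSum (fun a => (O a - O' a) * φ a) := by
  unfold normSqSum
  rw [Finset.mul_sum, Finset.mul_sum, ← Finset.sum_add_distrib]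
  refine Finset.sum_le_sum fun a _ => ?_
  have e : O a * φ a - O' a * ψ a = O' a * (φ a - ψ a) + (O a - O' a) * φ a := by ring
  simp only [Pi.sub_apply]
  rw [e]
  have h1 := norm_add_le (O' a * (φ a - ψ a)) ((O a - O' a) * φ a)
  rw [norm_mul (O' a), hO', one_mul] at h1
  generalize ‖φ a - ψ a‖ = x at *
  generalize ‖(O a - O' a) * φ a‖ = y at *
  have h2 := pow_le_pow_left₀ (norm_nonneg _) h1 2
  refine h2.trans ?_
  have h3 : 0 ≤ ε * (x - ε⁻¹ * y) ^ 2 := by positivity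
  have h4 : ε * (x - ε⁻¹ * y) ^ 2 = ε * x ^ 2 - 2 * x * y + ε⁻¹ * y ^ 2 := by
    field_simp
    ring
  nlinarith

end Vectors

/-! ### Branches of the collapsing measurement -/

namespace Gate

variable {B Out : Type} [Fintype B] [DecidableEq B] [DecidableEq Out]

/-- Unnormalized state after the collapsing measurement has returned `k`. -/
noncomputable def branch (g : Gate B Out) (φ : B → ℂ) (k : Out) : B → ℂ :=
  fun a => if g.label a = k then g.evolve φ a else 0

theorem prob_eq (g : Gate B Out) (φ : B → ℂ) (k : Out) :
    g.prob φ k = normSqSum (g.branch φ k) := by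
  unfold prob normSqSum branch
  exact Finset.sum_congr rfl fun a _ => by split_ifs <;> simp

theorem prob_nonneg (g : Gate B Out) (φ : B → ℂ) (k : Out) : 0 ≤ g.prob φ k := by
  rw [prob_eq]; exact normSqSum_nonneg _

/-- Linearity, which the normalized `post` lacks, is why the two runs are compared through
unnormalized branches. -/
theorem branch_sub (g : Gate B Out) (φ ψ : B → ℂ) (k : Out) :
    g.branch (φ - ψ) k = g.branch φ k - g.branch ψ k := by
  ext a
  simp only [branch, evolve, Matrix.mulVec_sub, Pi.sub_apply]
  split_ifs <;> simp

theorem branch_smul (g : Gate B Out) (c : ℂ) (φ : B → ℂ) (k : Out) :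
    g.branch (c • φ) k = c • g.branch φ k := by
  ext a
  simp only [branch, evolve, Matrix.mulVec_smul, Pi.smul_apply]
  split_ifs <;> simp

/-- The branches live on the disjoint fibres of `label`, and the unitary preserves the norm. -/
theorem sum_normSqSum_branch [Fintype Out] (g : Gate B Out) (φ : B → ℂ) :
    ∑ k, normSqSum (g.branch φ k) = normSqSum φ := by
  rw [← normSqSum_mulVec_unitary g.U φ]
  unfold normSqSum
  rw [Finset.sum_comm]
  refine Finset.sum_congr rfl fun a _ => ?_
  rw [Finset.sum_eq_single (g.label a)]
  · simp [branch, evolve]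
  · intro k _ hk
    simp [branch, hk.symm]
  · simp

theorem branch_eq_smul_post (g : Gate B Out) (φ : B → ℂ) (k : Out) :
    g.branch φ k = ((√(g.prob φ k) : ℝ) : ℂ) • g.post φ k := by
  ext a
  by_cases hp : √(g.prob φ k) = 0
  · have h0 : normSqSum (g.branch φ k) = 0 := by
      rw [← prob_eq]; exact (Real.sqrt_eq_zero (g.prob_nonneg φ k)).1 hp
    have ha := (Finset.sum_eq_zero_iff_of_nonneg (fun _ _ => by positivity)).1 h0 a
      (Finset.mem_univ a)
    simpa [hp] using ha
  · have hp' : ((√(g.prob φ k) : ℝ) : ℂ) ≠ 0 := by exact_mod_cast hp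
    simp only [branch, post, Pi.smul_apply, smul_eq_mul]
    split_ifs
    · field_simp
    · simp

theorem post_eq_zero_of_prob (g : Gate B Out) (φ : B → ℂ) (k : Out) (h : g.prob φ k = 0) :
    g.post φ k = 0 := by
  ext a; simp [post, h]

theorem normSqSum_post_of_prob_ne (g : Gate B Out) (φ : B → ℂ) (k : Out) (h : g.prob φ k ≠ 0) :
    normSqSum (g.post φ k) = 1 := by
  have e := normSqSum_smul (√(g.prob φ k)) (g.post φ k)
  rw [← branch_eq_smul_post, ← prob_eq, Real.sq_sqrt (g.prob_nonneg φ k)] at e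
  exact mul_left_cancel₀ h (by rw [← e, mul_one])

theorem normSqSum_post_le (g : Gate B Out) (φ : B → ℂ) (k : Out) :
    normSqSum (g.post φ k) ≤ 1 := by
  by_cases h : g.prob φ k = 0
  · simp [post_eq_zero_of_prob g φ k h, normSqSum]
  · exact (g.normSqSum_post_of_prob_ne φ k h).le

end Gate

/-! ### Acceptance and rejection -/

section Runs

variable {B Out : Type} [Fintype B] [DecidableEq B] [Fintype Out] [DecidableEq Out]

theorem acceptProb_nonneg (O : B → ℂ) (steps : List (Gate B Out × Bool)) (dec : List B → Bool)
    (φ : B → ℂ) : 0 ≤ acceptProb O steps dec φ := by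
  induction steps generalizing dec φ with
  | nil => unfold acceptProb; split_ifs <;> norm_num
  | cons s rest ih =>
    obtain ⟨g, q⟩ := s
    cases q <;> unfold acceptProb
    · exact Finset.sum_nonneg fun k _ => mul_nonneg (g.prob_nonneg φ k)
        (Finset.sum_nonneg fun a _ => mul_nonneg (by positivity) (ih _ _))
    · exact Finset.sum_nonneg fun k _ => mul_nonneg (g.prob_nonneg φ k) (ih _ _)

/-- Total probability is one. Outcomes of probability zero are treated separately, because their
post-measurement state is zero rather than a unit vector. -/
theorem acceptProb_add_not {O : B → ℂ} (hO : ∀ a, ‖O a‖ = 1) (steps : List (Gate B Out × Bool))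
    (dec : List B → Bool) (φ : B → ℂ) (hφ : normSqSum φ = 1) :
    acceptProb O steps dec φ + acceptProb O steps (fun v => !dec v) φ = 1 := by
  induction steps generalizing dec φ with
  | nil => unfold acceptProb; cases h : dec [] <;> simp [h]
  | cons s rest ih =>
    obtain ⟨g, q⟩ := s
    rw [← hφ, ← g.sum_normSqSum_branch φ]
    cases q <;> unfold acceptProb <;> rw [← Finset.sum_add_distrib] <;>
      refine Finset.sum_congr rfl fun k _ => ?_ <;> rw [← g.prob_eq, ← mul_add] <;>
      by_cases hp : g.prob φ k = 0 <;> try simp [hp]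
    · have h1 := g.normSqSum_post_of_prob_ne φ k hp
      rw [← Finset.sum_add_distrib]
      refine Eq.trans ?_ h1
      refine Finset.sum_congr rfl fun a _ => ?_
      rw [← mul_add, ih (fun v => dec (a :: v)) _ h1, mul_one]
    · rw [ih dec _ (by rw [normSqSum_phase hO, g.normSqSum_post_of_prob_ne φ k hp])]

/-! ### Affinity of two runs -/

/-- Bhattacharyya coefficient of the joint distributions of measurement outcomes and samples when
the same circuit is run with two oracles, as a function of two unnormalized initial states. -/
noncomputable def affinity (O O' : B → ℂ) :
    List (Gate B Out × Bool) → (B → ℂ) → (B → ℂ) → ℝ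
  | [], φ, ψ => √(normSqSum φ) * √(normSqSum ψ)
  | (g, true) :: rest, φ, ψ =>
      ∑ k, affinity O O' rest (fun a => O a * g.branch φ k a) (fun a => O' a * g.branch ψ k a)
  | (g, false) :: rest, φ, ψ =>
      ∑ k, absInner (g.branch φ k) (g.branch ψ k) /
        (√(normSqSum (g.branch φ k)) * √(normSqSum (g.branch ψ k))) *
          affinity O O' rest (g.branch φ k) (g.branch ψ k)

/-- The sample factor is a ratio and hence scale invariant, so only the final norms scale. This
passes between branches and normalized states. -/
theorem affinity_smul (O O' : B → ℂ) (steps : List (Gate B Out × Bool)) {c d : ℝ} (hc : 0 ≤ c)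
    (hd : 0 ≤ d) (φ ψ : B → ℂ) :
    affinity O O' steps ((c : ℂ) • φ) ((d : ℂ) • ψ) = c * d * affinity O O' steps φ ψ := by
  induction steps generalizing φ ψ with
  | nil =>
    simp only [affinity, sqrt_normSqSum_smul hc, sqrt_normSqSum_smul hd]; ring
  | cons s rest ih =>
    obtain ⟨g, q⟩ := s
    cases q <;> simp only [affinity, Finset.mul_sum, Gate.branch_smul] <;>
      refine Finset.sum_congr rfl fun k _ => ?_
    · rw [ih, absInner_smul hc hd, sqrt_normSqSum_smul hc, sqrt_normSqSum_smul hd]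
      by_cases h : c * d = 0
      · simp [h]
      · rw [show ∀ x y : ℝ, c * x * (d * y) = c * d * (x * y) by intros; ring,
          mul_div_mul_left _ _ h]
        ring
    · rw [phase_smul, phase_smul, ih]

theorem affinity_nonneg (O O' : B → ℂ) (steps : List (Gate B Out × Bool)) (φ ψ : B → ℂ) :
    0 ≤ affinity O O' steps φ ψ := by
  induction steps generalizing φ ψ with
  | nil => unfold affinity; positivity
  | cons s rest ih =>
    obtain ⟨g, q⟩ := s
    cases q <;> unfold affinity
    · exact Finset.sum_nonneg fun k _ => mul_nonneg
        (div_nonneg (absInner_nonneg _ _) (by positivity)) (ih _ _)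
    · exact Finset.sum_nonneg fun k _ => ih _ _

/-- Sample factors are at most one; dropping them leaves Cauchy–Schwarz over the outcomes of the
collapsing measurements. -/
theorem affinity_le {O O' : B → ℂ} (hO : ∀ a, ‖O a‖ = 1) (hO' : ∀ a, ‖O' a‖ = 1)
    (steps : List (Gate B Out × Bool)) (φ ψ : B → ℂ) :
    affinity O O' steps φ ψ ≤ √(normSqSum φ) * √(normSqSum ψ) := by
  induction steps generalizing φ ψ with
  | nil => exact le_rfl
  | cons s rest ih =>
    obtain ⟨g, q⟩ := s
    have key : ∑ k, √(normSqSum (g.branch φ k)) * √(normSqSum (g.branch ψ k)) ≤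
        √(normSqSum φ) * √(normSqSum ψ) := by
      rw [← g.sum_normSqSum_branch φ, ← g.sum_normSqSum_branch ψ]
      refine (Real.sum_mul_le_sqrt_mul_sqrt _ _ _).trans_eq ?_
      simp only [Real.sq_sqrt (normSqSum_nonneg _)]
    refine le_trans ?_ key
    cases q <;> unfold affinity <;> refine Finset.sum_le_sum fun k _ => ?_
    · exact (mul_le_of_le_one_left (affinity_nonneg _ _ _ _ _)
        (div_le_one_of_le₀ (absInner_le _ _) (by positivity))).trans (ih _ _)
    · refine (ih _ _).trans_eq ?_
      rw [normSqSum_phase hO, normSqSum_phase hO']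

theorem sum_sqrt_mul_le {ι : Type} (s : Finset ι) {x y : ι → ℝ} (hx : ∀ i, 0 ≤ x i)
    (hy : ∀ i, 0 ≤ y i) : ∑ i ∈ s, √(x i * y i) ≤ √((∑ i ∈ s, x i) * ∑ i ∈ s, y i) := by
  rw [Real.sqrt_mul (Finset.sum_nonneg fun i _ => hx i)]
  have h := Real.sum_mul_le_sqrt_mul_sqrt s (fun i => √(x i)) (fun i => √(y i))
  simp only [Real.sq_sqrt (hx _), Real.sq_sqrt (hy _), ← Real.sqrt_mul (hx _)] at h
  exact h

/-- The classical decision cannot decrease the affinity. -/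
theorem affinity_le_accept (O O' : B → ℂ) (steps : List (Gate B Out × Bool))
    (dec : List B → Bool) (φ ψ : B → ℂ) (hφ : normSqSum φ ≤ 1)
    (hψ : normSqSum ψ ≤ 1) (hO : ∀ a, ‖O a‖ = 1) (hO' : ∀ a, ‖O' a‖ = 1) :
    affinity O O' steps φ ψ ≤
      √(acceptProb O steps dec φ * acceptProb O' steps dec ψ) +
      √(acceptProb O steps (fun v => !dec v) φ * acceptProb O' steps (fun v => !dec v) ψ) := by
  induction steps generalizing dec φ ψ with
  | nil =>
    -- With no steps left the decision is fixed, so one of the two square roots is 1 and the other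
    -- is 0.
    have h : affinity O O' ([] : List (Gate B Out × Bool)) φ ψ ≤ 1 := by
      unfold affinity
      exact mul_le_one₀ (Real.sqrt_le_one.2 hφ) (Real.sqrt_nonneg _)
        (Real.sqrt_le_one.2 hψ)
    refine h.trans ?_
    unfold acceptProb
    cases h : dec [] <;> simp [h]
  | cons s rest ih =>
    obtain ⟨g, q⟩ := s
    have hp := fun φ k => g.prob_nonneg φ k
    cases q
    · unfold affinity acceptProb
      have hn : ∀ (O : B → ℂ) (dec : List B → Bool) φ k, 0 ≤ g.prob φ k *
          ∑ a, ‖g.post φ k a‖ ^ 2 * acceptProb O rest (fun v => dec (a :: v)) (g.post φ k) :=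
        fun O dec φ k => mul_nonneg (hp φ k) (Finset.sum_nonneg fun a _ =>
          mul_nonneg (by positivity) (acceptProb_nonneg _ _ _ _))
      refine le_trans ?_ (add_le_add
        (sum_sqrt_mul_le _ (fun k => hn O dec φ k) (fun k => hn O' dec ψ k))
        (sum_sqrt_mul_le _ (fun k => hn O (fun v => !dec v) φ k)
          (fun k => hn O' (fun v => !dec v) ψ k)))
      rw [← Finset.sum_add_distrib]
      refine Finset.sum_le_sum fun k _ => ?_
      set u := g.post φ k with hu
      set w := g.post ψ k with hw
      have hr : ∀ x y : ℝ, √(g.prob φ k * x * (g.prob ψ k * y)) =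
          √(g.prob φ k) * √(g.prob ψ k) * √(x * y) := fun x y => by
        rw [show g.prob φ k * x * (g.prob ψ k * y) = g.prob φ k * (g.prob ψ k * (x * y)) by ring,
          Real.sqrt_mul (hp φ k), Real.sqrt_mul (hp ψ k), mul_assoc]
      rw [hr, hr, ← mul_add]
      have hm : ∀ (O : B → ℂ) (dec : List B → Bool) (u : B → ℂ) a,
          0 ≤ ‖u a‖ ^ 2 * acceptProb O rest (fun v => dec (a :: v)) u :=
        fun O dec u a => mul_nonneg (by positivity) (acceptProb_nonneg _ _ _ _)
      have h1 : absInner u w * affinity O O' rest u w ≤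
          √((∑ a, ‖u a‖ ^ 2 * acceptProb O rest (fun v => dec (a :: v)) u) *
            ∑ a, ‖w a‖ ^ 2 * acceptProb O' rest (fun v => dec (a :: v)) w) +
          √((∑ a, ‖u a‖ ^ 2 * acceptProb O rest (fun v => !dec (a :: v)) u) *
            ∑ a, ‖w a‖ ^ 2 * acceptProb O' rest (fun v => !dec (a :: v)) w) := by
        refine le_trans ?_ (add_le_add
          (sum_sqrt_mul_le _ (hm O dec u) (hm O' dec w))
          (sum_sqrt_mul_le _ (hm O (fun v => !dec v) u) (hm O' (fun v => !dec v) w)))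
        rw [← Finset.sum_add_distrib, absInner, Finset.sum_mul]
        refine Finset.sum_le_sum fun a _ => ?_
        have hr : ∀ x y : ℝ, √(‖u a‖ ^ 2 * x * (‖w a‖ ^ 2 * y)) =
            ‖u a‖ * ‖w a‖ * √(x * y) := fun x y => by
          rw [show ‖u a‖ ^ 2 * x * (‖w a‖ ^ 2 * y) = (‖u a‖ * ‖w a‖) ^ 2 * (x * y) by ring,
            Real.sqrt_mul (by positivity), Real.sqrt_sq (by positivity)]
        rw [hr, hr, ← mul_add]
        exact mul_le_mul_of_nonneg_left (ih (fun v => dec (a :: v)) u w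
          (g.normSqSum_post_le φ k) (g.normSqSum_post_le ψ k)) (by positivity)
      refine le_trans ?_ (mul_le_mul_of_nonneg_left h1 (by positivity))
      rw [← g.prob_eq, ← g.prob_eq, g.branch_eq_smul_post φ k, g.branch_eq_smul_post ψ k,
        affinity_smul _ _ _ (Real.sqrt_nonneg _) (Real.sqrt_nonneg _),
        absInner_smul (Real.sqrt_nonneg _) (Real.sqrt_nonneg _)]
      by_cases h : √(g.prob φ k) * √(g.prob ψ k) = 0
      · simp [h]
      · rw [mul_div_cancel_left₀ _ h]
        exact le_of_eq (by ring)
    · unfold affinity acceptProb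
      have hn : ∀ (O : B → ℂ) (dec : List B → Bool) φ k, 0 ≤ g.prob φ k *
          acceptProb O rest dec (fun a => O a * g.post φ k a) :=
        fun O dec φ k => mul_nonneg (hp φ k) (acceptProb_nonneg _ _ _ _)
      refine le_trans ?_ (add_le_add
        (sum_sqrt_mul_le _ (fun k => hn O dec φ k) (fun k => hn O' dec ψ k))
        (sum_sqrt_mul_le _ (fun k => hn O (fun v => !dec v) φ k)
          (fun k => hn O' (fun v => !dec v) ψ k)))
      rw [← Finset.sum_add_distrib]
      refine Finset.sum_le_sum fun k _ => ?_
      have hr : ∀ x y : ℝ, √(g.prob φ k * x * (g.prob ψ k * y)) =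
          √(g.prob φ k) * √(g.prob ψ k) * √(x * y) := fun x y => by
        rw [show g.prob φ k * x * (g.prob ψ k * y) = g.prob φ k * (g.prob ψ k * (x * y)) by ring,
          Real.sqrt_mul (hp φ k), Real.sqrt_mul (hp ψ k), mul_assoc]
      rw [hr, hr, ← mul_add, g.branch_eq_smul_post φ k, g.branch_eq_smul_post ψ k, phase_smul,
        phase_smul, affinity_smul _ _ _ (Real.sqrt_nonneg _) (Real.sqrt_nonneg _)]
      exact mul_le_mul_of_nonneg_left (ih dec _ _
        (by rw [normSqSum_phase hO]; exact g.normSqSum_post_le φ k)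
        (by rw [normSqSum_phase hO']; exact g.normSqSum_post_le ψ k)) (by positivity)

/-! ### Distance of two runs -/

/-- Sum of the squared distances of the states of two runs with all the collapsing measurements
deferred, over the times of the non-collapsing measurements and the end. -/
noncomputable def runDist (O O' : B → ℂ) :
    List (Gate B Out × Bool) → (B → ℂ) → (B → ℂ) → ℝ
  | [], φ, ψ => normSqSum (φ - ψ)
  | (g, true) :: rest, φ, ψ =>
      ∑ k, runDist O O' rest (fun a => O a * g.branch φ k a) (fun a => O' a * g.branch ψ k a)
  | (g, false) :: rest, φ, ψ =>
      ∑ k, (normSqSum (g.branch φ k - g.branch ψ k) +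
        runDist O O' rest (g.branch φ k) (g.branch ψ k))

/-- For one sample the overlap loses at most half the squared distance of the states. The point is
that losses of successive samples add although the overlaps multiply. -/
theorem affinity_ge {O O' : B → ℂ} (hO : ∀ a, ‖O a‖ = 1) (hO' : ∀ a, ‖O' a‖ = 1)
    (steps : List (Gate B Out × Bool)) (φ ψ : B → ℂ) :
    (normSqSum φ + normSqSum ψ - runDist O O' steps φ ψ) / 2 ≤ affinity O O' steps φ ψ := by
  induction steps generalizing φ ψ with
  | nil =>
    unfold runDist affinity
    have h1 := normSqSum_sub_ge φ ψ
    have h2 := absInner_le φ ψ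
    linarith
  | cons s rest ih =>
    obtain ⟨g, q⟩ := s
    rw [← g.sum_normSqSum_branch φ, ← g.sum_normSqSum_branch ψ]
    cases q <;> unfold runDist affinity <;>
      rw [← Finset.sum_add_distrib, ← Finset.sum_sub_distrib, Finset.sum_div] <;>
      refine Finset.sum_le_sum fun k _ => ?_
    · set u := g.branch φ k
      set w := g.branch ψ k
      set s := √(normSqSum u) * √(normSqSum w) with hs
      have h1 := normSqSum_sub_ge u w
      have h2 := absInner_le u w
      have h3 := ih u w
      have h4 := affinity_le hO hO' rest u w
      have hs0 : 0 ≤ s := by positivity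
      have h5 : absInner u w / s ≤ 1 := div_le_one_of_le₀ h2 hs0
      have h6 : absInner u w / s * s = absInner u w := by
        -- If a branch vanishes, the quotient has the default value 0, which is consistent since
        -- `absInner u w` is 0 too.
        by_cases h0 : s = 0
        · have : absInner u w = 0 := le_antisymm (by rw [← h0]; exact h2) (absInner_nonneg _ _)
          simp [this]
        · exact div_mul_cancel₀ _ h0
      have h7 : 2 * s ≤ normSqSum u + normSqSum w := by
        have := two_mul_le_add_sq (√(normSqSum u)) (√(normSqSum w))
        rw [Real.sq_sqrt (normSqSum_nonneg _), Real.sq_sqrt (normSqSum_nonneg _)] at this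
        linarith
      -- With `r` the overlap ratio and `A` the remaining affinity, `(1 - r) * (s - A) ≥ 0` gives `r
      -- * A ≥ A + absInner u w - s`; now insert the bounds on the three terms.
      nlinarith [mul_nonneg (sub_nonneg.2 h5) (sub_nonneg.2 h4)]
    · refine le_trans (le_of_eq ?_) (ih _ _)
      rw [normSqSum_phase hO, normSqSum_phase hO']

/-- Total weight that the run with oracle `O` puts on queries at which `O'` differs from `O`. -/
noncomputable def queryWeight (O O' : B → ℂ) : List (Gate B Out × Bool) → (B → ℂ) → ℝ
  | [], _ => 0
  | (g, true) :: rest, φ =>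
      ∑ k, (normSqSum (fun a => (O a - O' a) * g.branch φ k a) +
        queryWeight O O' rest (fun a => O a * g.branch φ k a))
  | (g, false) :: rest, φ => ∑ k, queryWeight O O' rest (g.branch φ k)

theorem queryWeight_nonneg (O O' : B → ℂ) (steps : List (Gate B Out × Bool)) (φ : B → ℂ) :
    0 ≤ queryWeight O O' steps φ := by
  induction steps generalizing φ with
  | nil => exact le_rfl
  | cons s rest ih =>
    obtain ⟨g, q⟩ := s
    cases q <;> unfold queryWeight
    · exact Finset.sum_nonneg fun k _ => ih _
    · exact Finset.sum_nonneg fun k _ => add_nonneg (normSqSum_nonneg _) (ih _)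

/-- The run depends only on `O`, not on the index `i`. So the sum over `i` can be taken inside, at
each query and each basis state, where it is at most `D`. -/
theorem sum_queryWeight_le {ι : Type} (s : Finset ι) {O : B → ℂ} (O' : ι → B → ℂ)
    (hO : ∀ a, ‖O a‖ = 1) {D : ℝ} (hD : ∀ a, ∑ i ∈ s, ‖O a - O' i a‖ ^ 2 ≤ D)
    (steps : List (Gate B Out × Bool)) (φ : B → ℂ) :
    ∑ i ∈ s, queryWeight O (O' i) steps φ ≤ D * steps.countP (fun t => t.2) * normSqSum φ := by
  induction steps generalizing φ with
  | nil => simp [queryWeight]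
  | cons t rest ih =>
    obtain ⟨g, q⟩ := t
    rw [← g.sum_normSqSum_branch φ, Finset.mul_sum]
    cases q <;> unfold queryWeight <;> rw [Finset.sum_comm] <;>
      refine Finset.sum_le_sum fun k _ => ?_
    · simpa using ih (g.branch φ k)
    · rw [Finset.sum_add_distrib, List.countP_cons_of_pos (by simp)]
      have h1 := ih (fun a => O a * g.branch φ k a)
      rw [normSqSum_phase hO] at h1
      have h2 : ∑ i ∈ s, normSqSum (fun a => (O a - O' i a) * g.branch φ k a) ≤
          D * normSqSum (g.branch φ k) := by
        unfold normSqSum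
        rw [Finset.sum_comm, Finset.mul_sum]
        refine Finset.sum_le_sum fun a _ => ?_
        simp only [norm_mul, mul_pow, ← Finset.sum_mul]
        exact mul_le_mul_of_nonneg_right (hD a) (by positivity)
      push_cast
      nlinarith

/-- Each query multiplies the squared distance by `1 + ε` and adds `1 + ε⁻¹` times its weight, while
branching preserves it. The same final bound therefore holds at every sample time and at the end,
whence the factor `P + 1`. -/
theorem runDist_le {O O' : B → ℂ} (hO' : ∀ a, ‖O' a‖ = 1) {ε : ℝ} (hε : 0 < ε)
    (steps : List (Gate B Out × Bool)) (φ ψ : B → ℂ) :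
    runDist O O' steps φ ψ ≤ (1 + ε) ^ steps.countP (fun t => t.2) *
      (steps.countP (fun t => !t.2) + 1) *
        (normSqSum (φ - ψ) + (1 + ε⁻¹) * queryWeight O O' steps φ) := by
  induction steps generalizing φ ψ with
  | nil => simp [runDist, queryWeight]
  | cons t rest ih =>
    obtain ⟨g, q⟩ := t
    rw [← g.sum_normSqSum_branch (φ - ψ)]
    simp only [Gate.branch_sub]
    have hε' : (0 : ℝ) < 1 + ε⁻¹ := by positivity
    cases q <;> unfold runDist queryWeight <;>
      rw [Finset.mul_sum _ _ (1 + ε⁻¹), ← Finset.sum_add_distrib, Finset.mul_sum] <;>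
      refine Finset.sum_le_sum fun k _ => ?_
    · rw [List.countP_cons_of_neg (by simp), List.countP_cons_of_pos (by simp)]
      have h1 := ih (g.branch φ k) (g.branch ψ k)
      have h2 : (1 : ℝ) ≤ (1 + ε) ^ rest.countP (fun t => t.2) := one_le_pow₀ (by linarith)
      have h3 := normSqSum_nonneg (g.branch φ k - g.branch ψ k)
      have h4 := mul_nonneg hε'.le (queryWeight_nonneg O O' rest (g.branch φ k))
      generalize (1 + ε⁻¹) * queryWeight O O' rest (g.branch φ k) = M at *
      generalize normSqSum (g.branch φ k - g.branch ψ k) = n at *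
      generalize (1 + ε) ^ rest.countP (fun t => t.2) = E at *
      push_cast
      nlinarith [mul_nonneg (sub_nonneg.2 h2) (add_nonneg h3 h4)]
    · rw [List.countP_cons_of_pos (by simp), List.countP_cons_of_neg (by simp)]
      refine (ih _ _).trans ?_
      have h1 := normSqSum_phase_sub_le (O := O) hO' hε (g.branch φ k) (g.branch ψ k)
      rw [pow_succ, mul_assoc, mul_assoc, mul_assoc]
      refine mul_le_mul_of_nonneg_left ?_ (by positivity)
      rw [mul_left_comm]
      refine mul_le_mul_of_nonneg_left ?_ (by positivity)
      have h2 := mul_nonneg hε'.le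
        (queryWeight_nonneg O O' rest (fun a => O a * g.branch φ k a))
      have h3 := mul_nonneg hε'.le (normSqSum_nonneg (fun a => (O a - O' a) * g.branch φ k a))
      nlinarith [mul_nonneg hε.le h2, mul_nonneg hε.le h3]

/-- If a circuit distinguishes two oracles, then the two runs are far apart. -/
theorem runDist_ge {O O' : B → ℂ} (hO : ∀ a, ‖O a‖ = 1) (hO' : ∀ a, ‖O' a‖ = 1)
    (steps : List (Gate B Out × Bool)) (dec : List B → Bool) {φ ψ : B → ℂ}
    (hφ : normSqSum φ = 1) (hψ : normSqSum ψ = 1) :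
    (acceptProb O steps dec φ - acceptProb O' steps dec ψ) ^ 2 ≤ runDist O O' steps φ ψ := by
  have h1 := affinity_ge hO hO' steps φ ψ
  have h2 := affinity_le_accept O O' steps dec φ ψ hφ.le hψ.le hO hO'
  have hx := acceptProb_add_not hO steps dec φ hφ
  have hy := acceptProb_add_not hO' steps dec ψ hψ
  have x0 := acceptProb_nonneg O steps dec φ
  have y0 := acceptProb_nonneg O' steps dec ψ
  have x1 := acceptProb_nonneg O steps (fun v => !dec v) φ
  have y1 := acceptProb_nonneg O' steps (fun v => !dec v) ψ
  generalize acceptProb O steps dec φ = x at *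
  generalize acceptProb O' steps dec ψ = y at *
  generalize acceptProb O steps (fun v => !dec v) φ = x' at *
  generalize acceptProb O' steps (fun v => !dec v) ψ = y' at *
  obtain rfl : x' = 1 - x := by linarith
  obtain rfl : y' = 1 - y := by linarith
  have e1 := Real.sq_sqrt (mul_nonneg x0 y0)
  have e2 := Real.sq_sqrt (mul_nonneg x1 y1)
  have e3 : √(x * y) * √((1 - x) * (1 - y)) = √(x * (1 - x)) * √(y * (1 - y)) := by
    rw [← Real.sqrt_mul (mul_nonneg x0 y0), ← Real.sqrt_mul (mul_nonneg x0 x1)]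
    congr 1; ring
  have e4 := two_mul_le_add_sq (√(x * (1 - x))) (√(y * (1 - y)))
  rw [Real.sq_sqrt (mul_nonneg x0 x1), Real.sq_sqrt (mul_nonneg y0 y1)] at e4
  -- Expand the square and apply AM-GM to the cross term `e3`. With `S` the sum of the roots, `1 - S
  -- ^ 2 ≤ 2 * (1 - S)`, and the right side is at most the run distance.
  have e5 : (√(x * y) + √((1 - x) * (1 - y))) ^ 2 ≤ 1 - (x - y) ^ 2 := by nlinarith
  nlinarith [sq_nonneg (√(x * y) + √((1 - x) * (1 - y)) - 1)]

end Runs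

/-! ### Lower bounds -/

section LowerBounds

variable {N : ℕ}

theorem norm_queryPhase (f : Fin N → Fin N) (r : Fin N × Fin N) : ‖queryPhase f r‖ = 1 := by
  have e : 2 * Real.pi * Complex.I * ((r.2 : ℕ) : ℂ) * ((f r.1 : ℕ) : ℂ) / (N : ℂ) =
      ((2 * Real.pi * (r.2 : ℕ) * (f r.1 : ℕ) / N : ℝ) : ℂ) * Complex.I := by
    push_cast; ring
  rw [queryPhase, e, Complex.norm_exp_ofReal_mul_I]

theorem norm_prod_queryPhase {Q : ℕ} (f : Fin N → Fin N) (r : Fin Q → Fin N × Fin N) :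
    ‖∏ j, queryPhase f (r j)‖ = 1 := by
  simp [norm_prod, norm_queryPhase]

theorem queryPhase_update_of_ne (f : Fin N → Fin N) {x : Fin N} (z : Fin N) {r : Fin N × Fin N}
    (h : r.1 ≠ x) : queryPhase (Function.update f x z) r = queryPhase f r := by
  simp [queryPhase, Function.update_of_ne h]

/-- Changing the input at one random position rarely affects `Q` parallel queries. -/
theorem sum_norm_sub_update_le {Q : ℕ} (f : Fin N → Fin N) (z : Fin N) (s : Finset (Fin N))
    (r : Fin Q → Fin N × Fin N) :
    ∑ x ∈ s, ‖∏ j, queryPhase f (r j) - ∏ j, queryPhase (Function.update f x z) (r j)‖ ^ 2 ≤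
      4 * Q := by
  classical
  have h1 : ∀ x ∈ s,
      ‖∏ j, queryPhase f (r j) - ∏ j, queryPhase (Function.update f x z) (r j)‖ ^ 2 ≤
        if x ∈ Finset.univ.image (fun j => (r j).1) then (4 : ℝ) else 0 := by
    intro x _
    split_ifs with h
    · have h2 := norm_sub_le (∏ j, queryPhase f (r j))
        (∏ j, queryPhase (Function.update f x z) (r j))
      rw [norm_prod_queryPhase, norm_prod_queryPhase] at h2
      nlinarith [norm_nonneg (∏ j, queryPhase f (r j) -
        ∏ j, queryPhase (Function.update f x z) (r j))]
    · have h2 : ∀ j, (r j).1 ≠ x := fun j hj => h (by simpa using ⟨j, hj⟩)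
      simp [queryPhase_update_of_ne f z (h2 _)]
  refine (Finset.sum_le_sum h1).trans ?_
  rw [← Finset.sum_filter, Finset.sum_const, nsmul_eq_mul, mul_comm]
  refine mul_le_mul_of_nonneg_left ?_ (by norm_num)
  have h3 : (s.filter (· ∈ Finset.univ.image (fun j => (r j).1))).card ≤ Q := by
    refine (Finset.card_le_card (t := Finset.univ.image (fun j => (r j).1)) fun x hx =>
      (Finset.mem_filter.1 hx).2).trans ?_
    exact Finset.card_image_le.trans (by simp)
  exact_mod_cast h3

theorem sum_norm_sub_update_le_single (f : Fin N → Fin N) (z : Fin N) (s : Finset (Fin N))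
    (r : Fin N × Fin N) :
    ∑ x ∈ s, ‖queryPhase f r - queryPhase (Function.update f x z) r‖ ^ 2 ≤ 4 := by
  simpa using sum_norm_sub_update_le (Q := 1) f z s (fun _ => r)

theorem almostInjective_update_id {x z : Fin N} (h : x ≠ z) :
    AlmostInjective (Function.update id x z) := by
  refine ⟨x, z, h, by simp [Function.update_of_ne h.symm], fun u v huv hf => ?_⟩
  by_cases hu : u = x
  · subst hu
    rw [Function.update_self, Function.update_of_ne huv.symm] at hf
    exact Or.inl ⟨rfl, hf.symm⟩
  · by_cases hv : v = x
    · subst hv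
      rw [Function.update_self, Function.update_of_ne hu] at hf
      exact Or.inr ⟨hf, rfl⟩
    · rw [Function.update_of_ne hu, Function.update_of_ne hv] at hf
      exact absurd hf huv

theorem accept_gap {accept : (Fin N → Fin N) → ℝ}
    (h : DecidesDistinctnessOn {f | Function.Injective f ∨ AlmostInjective f} accept)
    {x z : Fin N} (hx : x ≠ z) :
    1 / 9 ≤ (accept id - accept (Function.update id x z)) ^ 2 := by
  have ha := almostInjective_update_id hx
  obtain ⟨u, v, huv, hf, -⟩ := ha
  have h1 := (h id (Or.inl Function.injective_id)).2
    (fun ⟨u, v, huv, hf⟩ => huv hf)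
  have h2 := (h _ (Or.inr (almostInjective_update_id hx))).1 ⟨u, v, huv, hf⟩
  nlinarith

theorem one_add_inv_pow_le (q : ℕ) : (1 + ((q : ℝ) + 1)⁻¹) ^ q ≤ 3 := by
  have h1 : (1 + ((q : ℝ) + 1)⁻¹) ^ q ≤ Real.exp (((q : ℝ) + 1)⁻¹) ^ q := by
    refine pow_le_pow_left₀ (by positivity) ?_ q
    have := Real.add_one_le_exp (((q : ℝ) + 1)⁻¹)
    linarith
  rw [← Real.exp_nat_mul] at h1
  refine h1.trans ((Real.exp_le_exp.2 (?_ : _ ≤ (1 : ℝ))).trans ?_)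
  · rw [← div_eq_mul_inv]
    exact div_le_one_of_le₀ (by linarith) (by positivity)
  · exact Real.exp_one_lt_three.le

/-- Add up the distinguishing condition over the `N - 1` positions `x ≠ z`. The constant is `9 * 3 *
4`: squared gap, `(1 + ε) ^ q`, and largest squared phase difference. -/
theorem PDQPAlgorithm.card_le (A : PDQPAlgorithm N) (hN : 2 ≤ N)
    (h : DecidesDistinctnessOn {f | Function.Injective f ∨ AlmostInjective f} A.accept) :
    ((N : ℝ) - 1) ≤ 108 * (A.samples + 1) * (A.queries + 2) * A.queries := by
  classical
  set z : Fin N := ⟨0, by omega⟩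
  set s : Finset (Fin N) := Finset.univ.erase z
  set q := A.queries with hq
  set p := A.samples with hp
  set φ : (Fin N × Fin N) × A.W → ℂ := Pi.single A.init 1
  set O : (Fin N → Fin N) → (Fin N × Fin N) × A.W → ℂ := fun f a => queryPhase f a.1
  have hO : ∀ f a, ‖O f a‖ = 1 := fun f a => norm_queryPhase f a.1
  have hφ : normSqSum φ = 1 := normSqSum_single _
  have hcard : (s.card : ℝ) = N - 1 := by
    rw [Finset.card_erase_of_mem (Finset.mem_univ z), Finset.card_univ, Fintype.card_fin,
      Nat.cast_sub (by omega), Nat.cast_one]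
  have h1 := sum_queryWeight_le s (fun x => O (Function.update id x z)) (hO id) (D := 4)
    (fun a => sum_norm_sub_update_le_single id z s a.1) A.steps φ
  rw [hφ, mul_one, ← PDQPAlgorithm.queries, ← hq] at h1
  have h2 : ∀ x ∈ s, (1 : ℝ) / 9 ≤ 3 * (p + 1) * (q + 2) *
      queryWeight (O id) (O (Function.update id x z)) A.steps φ := by
    intro x hx
    -- This `ε` keeps `(1 + ε) ^ q` below 3 while `1 + ε⁻¹ = q + 2` stays linear; `q + 1` in place
    -- of `q` covers `q = 0`.
    have hε : (0 : ℝ) < ((q : ℝ) + 1)⁻¹ := by positivity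
    have h3 := accept_gap h (Finset.ne_of_mem_erase hx)
    have h4 := runDist_ge (hO id) (hO (Function.update id x z)) A.steps A.dec hφ hφ
    have h5 := runDist_le (O := O id) (hO (Function.update id x z)) hε A.steps φ φ
    rw [← PDQPAlgorithm.queries, ← PDQPAlgorithm.samples, ← hq, ← hp, inv_inv, sub_self] at h5
    have h6 := queryWeight_nonneg (O id) (O (Function.update id x z)) A.steps φ
    have h7 := one_add_inv_pow_le q
    refine h3.trans (h4.trans (h5.trans ?_))
    have h8 : normSqSum (0 : (Fin N × Fin N) × A.W → ℂ) = 0 := by simp [normSqSum]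
    rw [h8, zero_add, show (1 : ℝ) + (q + 1) = q + 2 by ring, ← mul_assoc]
    gcongr
  have h3 := Finset.sum_le_sum h2
  rw [Finset.sum_const, nsmul_eq_mul, hcard, ← Finset.mul_sum] at h3
  have h4 := mul_le_mul_of_nonneg_left h1
    (by positivity : (0 : ℝ) ≤ 3 * (p + 1) * (q + 2))
  linarith

/-- Nothing after the parallel round depends on the input, so the distance is created once, with no
factor `Q` from accumulation. -/
theorem NonadaptivePDQPAlgorithm.card_le (A : NonadaptivePDQPAlgorithm N) (hN : 2 ≤ N)
    (h : DecidesDistinctnessOn {f | Function.Injective f ∨ AlmostInjective f} A.accept) :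
    ((N : ℝ) - 1) ≤ 36 * (A.samples + 1) * A.queries := by
  classical
  set z : Fin N := ⟨0, by omega⟩
  set s : Finset (Fin N) := Finset.univ.erase z
  set ψ : (Fin A.queries → Fin N × Fin N) × A.W → ℂ :=
    Matrix.mulVec (A.U₀ : Matrix _ _ ℂ) (Pi.single A.init 1)
  set φ : (Fin N → Fin N) → (Fin A.queries → Fin N × Fin N) × A.W → ℂ :=
    fun f a => A.phase f a * ψ a
  have hO : ∀ f a, ‖A.phase f a‖ = 1 := fun f a => norm_prod_queryPhase f a.1
  have hψ : normSqSum ψ = 1 := by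
    rw [normSqSum_mulVec_unitary, normSqSum_single]
  have hφ : ∀ f, normSqSum (φ f) = 1 := fun f => by
    rw [normSqSum_phase (hO f), hψ]
  have hcard : (s.card : ℝ) = N - 1 := by
    rw [Finset.card_erase_of_mem (Finset.mem_univ z), Finset.card_univ, Fintype.card_fin,
      Nat.cast_sub (by omega), Nat.cast_one]
  have h1 : ∑ x ∈ s, normSqSum (φ id - φ (Function.update id x z)) ≤ 4 * A.queries := by
    unfold normSqSum
    rw [Finset.sum_comm]
    have hb : ∀ a, ∑ x ∈ s, ‖(φ id - φ (Function.update id x z)) a‖ ^ 2 ≤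
        4 * A.queries * ‖ψ a‖ ^ 2 := fun a => by
      simp only [φ, Pi.sub_apply, ← sub_mul, norm_mul, mul_pow, ← Finset.sum_mul]
      exact mul_le_mul_of_nonneg_right (sum_norm_sub_update_le id z s a.1) (by positivity)
    refine (Finset.sum_le_sum fun a _ => hb a).trans ?_
    rw [← Finset.mul_sum]
    exact le_of_eq (by rw [← normSqSum, hψ, mul_one])
  have hw : ∀ (O O' : (Fin A.queries → Fin N × Fin N) × A.W → ℂ)
      (l : List (Gate ((Fin A.queries → Fin N × Fin N) × A.W) A.Out)) φ,
      queryWeight O O' (l.map fun g => (g, false)) φ = 0 := by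
    intro O O' l
    induction l with
    | nil => intro φ; rfl
    | cons g l ih => intro φ; simp [queryWeight, ih]
  have h2 : ∀ x ∈ s, (1 : ℝ) / 9 ≤ (A.samples + 1) *
      normSqSum (φ id - φ (Function.update id x z)) := by
    intro x hx
    have h3 := accept_gap h (Finset.ne_of_mem_erase hx)
    have h4 := runDist_ge (hO id) (hO (Function.update id x z))
      (A.steps.map fun g => (g, false)) A.dec (hφ id) (hφ (Function.update id x z))
    -- Any `ε` works: the remaining steps contain no query, so the exponent and the query weight are
    -- zero.
    have h5 := runDist_le (O := A.phase id) (hO (Function.update id x z)) one_pos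
      (A.steps.map fun g => (g, false)) (φ id) (φ (Function.update id x z))
    rw [hw, mul_zero, add_zero] at h5
    refine h3.trans (h4.trans (h5.trans (le_of_eq ?_)))
    simp [List.countP_map, Function.comp_def, NonadaptivePDQPAlgorithm.samples]
  have h3 := Finset.sum_le_sum h2
  rw [Finset.sum_const, nsmul_eq_mul, hcard, ← Finset.mul_sum] at h3
  have h4 := mul_le_mul_of_nonneg_left h1 (by positivity : (0 : ℝ) ≤ A.samples + 1)
  linarith

/-- `card_le` bounds `N` by a multiple of the cube of the complexity; the exponent `1 / 4` results
from weakening the cube to a fourth power, with `1 + 648 ≤ 6 ^ 4`. -/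
theorem PDQPAlgorithm.lower_bound (hN : 2 ≤ N) (A : PDQPAlgorithm N)
    (h : DecidesDistinctnessOn {f | Function.Injective f ∨ AlmostInjective f} A.accept) :
    1 / 6 * (N : ℝ) ^ (1 / 4 : ℝ) ≤ (A.queries : ℝ) + (A.samples : ℝ) := by
  have h1 := A.card_le hN h
  have hN' : (2 : ℝ) ≤ N := by exact_mod_cast hN
  have hq : (1 : ℝ) ≤ A.queries := by
    rcases Nat.eq_zero_or_pos A.queries with h0 | h0
    · rw [h0] at h1; norm_num at h1; linarith
    · exact_mod_cast h0
  have hp : (0 : ℝ) ≤ A.samples := by positivity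
  generalize (A.queries : ℝ) = q at *
  generalize (A.samples : ℝ) = p at *
  have h2 : 108 * (p + 1) * (q + 2) * q ≤ 108 * (2 * (q + p)) * (3 * (q + p)) * (q + p) := by
    gcongr <;> linarith
  have h3 : (q + p) ^ 3 ≤ (q + p) ^ 4 := pow_le_pow_right₀ (by linarith) (by norm_num)
  have h4 : (N : ℝ) ≤ (6 * (q + p)) ^ 4 := by nlinarith
  have h5 := Real.rpow_le_rpow (by linarith) h4 (by norm_num : (0 : ℝ) ≤ 1 / 4)
  rw [← Real.rpow_natCast, ← Real.rpow_mul (by linarith)] at h5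
  norm_num at h5 ⊢
  linarith

theorem NonadaptivePDQPAlgorithm.lower_bound (hN : 2 ≤ N) (A : NonadaptivePDQPAlgorithm N)
    (h : DecidesDistinctnessOn {f | Function.Injective f ∨ AlmostInjective f} A.accept) :
    1 / 12 * √(N : ℝ) ≤ (A.queries : ℝ) + (A.samples : ℝ) := by
  have h1 := A.card_le hN h
  have hN' : (2 : ℝ) ≤ N := by exact_mod_cast hN
  have hq : (1 : ℝ) ≤ A.queries := by
    rcases Nat.eq_zero_or_pos A.queries with h0 | h0
    · rw [h0] at h1; norm_num at h1; linarith
    · exact_mod_cast h0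
  have hp : (0 : ℝ) ≤ A.samples := by positivity
  generalize (A.queries : ℝ) = q at *
  generalize (A.samples : ℝ) = p at *
  have h2 : 36 * (p + 1) * q ≤ 36 * (2 * (q + p)) * (q + p) := by
    gcongr <;> linarith
  have h4 : √(N : ℝ) ≤ 12 * (q + p) := Real.sqrt_le_iff.2 ⟨by linarith, by nlinarith⟩
  linarith

end LowerBounds

/-! ### Independent samples -/

section Samples

variable {B : Type} [Fintype B]

/-- Expectation of `F` on a list of `n` independent samples of `μ`. -/
def sampleExp (μ : B → ℝ) : ℕ → (List B → ℝ) → ℝ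
  | 0, F => F []
  | n + 1, F => ∑ a, μ a * sampleExp μ n (fun v => F (a :: v))

theorem sampleExp_mono {μ : B → ℝ} (hμ : ∀ a, 0 ≤ μ a) (n : ℕ) {F G : List B → ℝ}
    (h : ∀ v, F v ≤ G v) : sampleExp μ n F ≤ sampleExp μ n G := by
  induction n generalizing F G with
  | zero => exact h []
  | succ n ih =>
    exact Finset.sum_le_sum fun a _ => mul_le_mul_of_nonneg_left (ih fun v => h _) (hμ a)

theorem sampleExp_add (μ : B → ℝ) (n : ℕ) (F G : List B → ℝ) :
    sampleExp μ n (fun v => F v + G v) = sampleExp μ n F + sampleExp μ n G := by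
  induction n generalizing F G with
  | zero => rfl
  | succ n ih =>
    simp only [sampleExp, ih, mul_add, Finset.sum_add_distrib]

theorem sampleExp_one {μ : B → ℝ} (hμ : ∑ a, μ a = 1) (n : ℕ) :
    sampleExp μ n (fun _ => 1) = 1 := by
  induction n with
  | zero => rfl
  | succ n ih => simp [sampleExp, ih, hμ]

theorem sampleExp_eq_zero {μ : B → ℝ} (n : ℕ) {F : List B → ℝ}
    (h : ∀ v : List B, (∀ a ∈ v, μ a ≠ 0) → F v = 0) : sampleExp μ n F = 0 := by
  induction n generalizing F with
  | zero => exact h [] (by simp)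
  | succ n ih =>
    refine Finset.sum_eq_zero fun a _ => ?_
    by_cases ha : μ a = 0
    · simp [ha]
    · rw [ih fun v hv => h _ (by simpa [ha] using hv), mul_zero]

open Classical in
theorem sampleExp_miss (μ : B → ℝ) (n : ℕ) (S : Set B) :
    sampleExp μ n (fun v => if ∀ a ∈ v, a ∉ S then 1 else 0) =
      (∑ a, if a ∈ S then 0 else μ a) ^ n := by
  induction n with
  | zero => simp [sampleExp]
  | succ n ih =>
    rw [sampleExp, pow_succ', Finset.sum_mul]
    refine Finset.sum_congr rfl fun a _ => ?_
    by_cases ha : a ∈ S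
    · have : sampleExp μ n (fun v => if ∀ b ∈ a :: v, b ∉ S then (1 : ℝ) else 0) = 0 :=
        sampleExp_eq_zero n fun v _ => by simp [ha]
      rw [this]; simp [ha]
    · simp [ha, ← ih]

/-- The power is at most `exp (-2)`, and `exp 2 > 6`. Two failures of `1 / 6` each use up the
allowed error `1 / 3`. -/
theorem one_sub_inv_pow_le {K n : ℕ} (hK : 1 ≤ K) (hn : 2 * K ≤ n) :
    (1 - (K : ℝ)⁻¹) ^ n ≤ 1 / 6 := by
  have hK' : (1 : ℝ) ≤ K := by exact_mod_cast hK
  have h0 : 0 ≤ 1 - (K : ℝ)⁻¹ := sub_nonneg.2 (inv_le_one_of_one_le₀ hK')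
  have h1 : 1 - (K : ℝ)⁻¹ ≤ 1 := sub_le_self _ (by positivity)
  have h2 : (1 - (K : ℝ)⁻¹) ^ (2 * K) ≤ Real.exp (-(K : ℝ)⁻¹) ^ (2 * K) := by
    refine pow_le_pow_left₀ h0 ?_ _
    have := Real.add_one_le_exp (-(K : ℝ)⁻¹)
    linarith
  refine (pow_le_pow_of_le_one h0 h1 hn).trans (h2.trans ?_)
  have e : ((2 * K : ℕ) : ℝ) * -(K : ℝ)⁻¹ = -2 := by
    push_cast; field_simp
  rw [← Real.exp_nat_mul, e, Real.exp_neg, one_div]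
  refine inv_anti₀ (by norm_num) ?_
  have h3 := Real.exp_one_gt_d9
  have h4 : Real.exp 2 = Real.exp 1 * Real.exp 1 := by rw [← Real.exp_add]; norm_num
  rw [h4]; nlinarith

open Classical in
/-- Two events of probability at least `1 / K` are both seen in `2 K` samples. -/
theorem sampleExp_ge {μ : B → ℝ} (hμ : ∀ a, 0 ≤ μ a) (hμ1 : ∑ a, μ a = 1) {K n : ℕ} (hK : 1 ≤ K)
    (hn : 2 * K ≤ n) {S T : Set B} (hS : (K : ℝ)⁻¹ ≤ ∑ a, if a ∈ S then μ a else 0)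
    (hT : (K : ℝ)⁻¹ ≤ ∑ a, if a ∈ T then μ a else 0) {F : List B → ℝ} (hF : ∀ v, 0 ≤ F v)
    (h : ∀ v : List B, (∃ a ∈ v, a ∈ S) → (∃ a ∈ v, a ∈ T) → F v = 1) :
    2 / 3 ≤ sampleExp μ n F := by
  have miss : ∀ S : Set B, (K : ℝ)⁻¹ ≤ ∑ a, (if a ∈ S then μ a else 0) →
      sampleExp μ n (fun v => if ∀ a ∈ v, a ∉ S then 1 else 0) ≤ 1 / 6 := by
    intro S hS
    rw [sampleExp_miss]
    refine (pow_le_pow_left₀ (Finset.sum_nonneg fun a _ => ?_) ?_ n).trans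
      (one_sub_inv_pow_le hK hn)
    · split_ifs
      · exact le_rfl
      · exact hμ a
    · have : (∑ a, if a ∈ S then 0 else μ a) + ∑ a, (if a ∈ S then μ a else 0) = 1 := by
        rw [← hμ1, ← Finset.sum_add_distrib]
        exact Finset.sum_congr rfl fun a _ => by split_ifs <;> simp
      linarith
  -- Union bound: every list either satisfies `F v = 1`, or misses `S`, or misses `T`.
  have h1 : sampleExp μ n (fun _ => 1) ≤ sampleExp μ n (fun v =>
      (F v + if ∀ a ∈ v, a ∉ S then 1 else 0) + if ∀ a ∈ v, a ∉ T then 1 else 0) := by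
    refine sampleExp_mono hμ n fun v => ?_
    have h0 := hF v
    split_ifs with hs ht ht
    · linarith
    · linarith
    · linarith
    · push Not at hs ht
      rw [h v hs ht]; norm_num
  rw [sampleExp_add, sampleExp_add, sampleExp_one hμ1] at h1
  linarith [miss S hS, miss T hT]

/-! ### Detecting a collision in samples of registers -/

variable {N Q : ℕ}

open Classical in
/-- Some two registers in the samples show different positions with equal values. -/
noncomputable def collisionSeen (read : B → Fin Q → Fin N × Fin N) (v : List B) : Bool :=
  decide (∃ a ∈ v, ∃ b ∈ v, ∃ i j, (read a i).1 ≠ (read b j).1 ∧ (read a i).2 = (read b j).2)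

open Classical in
-- The error is one-sided: the support condition makes every displayed pair a true value of `f`, so
-- only an existing collision can be reported.
theorem collisionSeen_decides {μ : B → ℝ} (hμ : ∀ a, 0 ≤ μ a) (hμ1 : ∑ a, μ a = 1) {K n : ℕ}
    (hK : 1 ≤ K) (hn : 2 * K ≤ n) (read : B → Fin Q → Fin N × Fin N) (f : Fin N → Fin N)
    (hsupp : ∀ a, μ a ≠ 0 → ∀ j, (read a j).2 = f (read a j).1)
    (hhit : ∀ x, ∃ j, (K : ℝ)⁻¹ ≤ ∑ a, if read a j = (x, f x) then μ a else 0) :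
    (HasCollision f →
      2 / 3 ≤ sampleExp μ n (fun v => if collisionSeen read v = true then 1 else 0)) ∧
    (¬ HasCollision f →
      sampleExp μ n (fun v => if collisionSeen read v = true then 1 else 0) ≤ 1 / 3) := by
  constructor
  · rintro ⟨x, y, hxy, hf⟩
    obtain ⟨i, hi⟩ := hhit x
    obtain ⟨j, hj⟩ := hhit y
    refine sampleExp_ge hμ hμ1 hK hn (S := {a | read a i = (x, f x)})
      (T := {a | read a j = (y, f y)}) (by convert hi; rfl) (by convert hj; rfl)
      (fun v => by split_ifs <;> norm_num) ?_
    rintro v ⟨a, ha, has⟩ ⟨b, hb, hbt⟩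
    rw [if_pos]
    rw [collisionSeen, decide_eq_true_eq]
    refine ⟨a, ha, b, hb, i, j, ?_⟩
    rw [Set.mem_ofPred_eq] at has hbt
    rw [has, hbt]
    exact ⟨hxy, hf⟩
  · intro hf
    rw [sampleExp_eq_zero]
    · norm_num
    · intro v hv
      rw [if_neg]
      rw [collisionSeen, decide_eq_true_eq]
      rintro ⟨a, ha, b, hb, i, j, hne, he⟩
      rw [hsupp a (hv a ha), hsupp b (hv b hb)] at he
      exact hf ⟨_, _, hne, he⟩

end Samples

/-! ### Circuits without collapsing measurements -/

section Circuits

variable {B : Type} [Fintype B] [DecidableEq B]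

/-- The gate that applies `U` and measures nothing. -/
def unitaryGate (U : Matrix.unitaryGroup B ℂ) : Gate B Unit := ⟨U, fun _ => ()⟩

theorem unitaryGate_prob (U : Matrix.unitaryGroup B ℂ) {φ : B → ℂ} (hφ : normSqSum φ = 1) :
    (unitaryGate U).prob φ () = 1 := by
  rw [← hφ, ← (unitaryGate U).sum_normSqSum_branch φ, Gate.prob_eq]
  simp

theorem unitaryGate_post (U : Matrix.unitaryGroup B ℂ) {φ : B → ℂ} (hφ : normSqSum φ = 1) :
    (unitaryGate U).post φ () = Matrix.mulVec (U : Matrix B B ℂ) φ := by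
  ext a
  simp only [Gate.post, unitaryGate_prob U hφ]
  simp [unitaryGate, Gate.evolve]

theorem acceptProb_query_cons (O : B → ℂ) (U : Matrix.unitaryGroup B ℂ)
    (rest : List (Gate B Unit × Bool)) (dec : List B → Bool) {φ : B → ℂ} (hφ : normSqSum φ = 1) :
    acceptProb O ((unitaryGate U, true) :: rest) dec φ =
      acceptProb O rest dec (fun a => O a * Matrix.mulVec (U : Matrix B B ℂ) φ a) := by
  rw [acceptProb]
  simp [unitaryGate_prob U hφ, unitaryGate_post U hφ]

theorem acceptProb_sample_cons (O : B → ℂ) (U : Matrix.unitaryGroup B ℂ)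
    (rest : List (Gate B Unit × Bool)) (dec : List B → Bool) {φ : B → ℂ} (hφ : normSqSum φ = 1) :
    acceptProb O ((unitaryGate U, false) :: rest) dec φ =
      ∑ a, ‖Matrix.mulVec (U : Matrix B B ℂ) φ a‖ ^ 2 *
        acceptProb O rest (fun v => dec (a :: v)) (Matrix.mulVec (U : Matrix B B ℂ) φ) := by
  rw [acceptProb]
  simp [unitaryGate_prob U hφ, unitaryGate_post U hφ]

/-- Sampling leaves the state undisturbed, so repeating it gives independent samples of one
distribution. -/
theorem acceptProb_replicate_sample (O : B → ℂ) (n : ℕ) (dec : List B → Bool) {φ : B → ℂ}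
    (hφ : normSqSum φ = 1) :
    acceptProb O (List.replicate n (unitaryGate (1 : Matrix.unitaryGroup B ℂ), false)) dec φ =
      sampleExp (fun a => ‖φ a‖ ^ 2) n (fun v => if dec v = true then 1 else 0) := by
  induction n generalizing dec with
  | zero => rfl
  | succ n ih =>
    rw [List.replicate_succ, acceptProb_sample_cons _ _ _ _ hφ, sampleExp]
    simp only [Matrix.UnitaryGroup.one_val, Matrix.one_mulVec, ih]

theorem acceptProb_unitary_samples (O : B → ℂ) (U : Matrix.unitaryGroup B ℂ) (n : ℕ)
    (dec : List B → Bool) {φ : B → ℂ} (hφ : normSqSum φ = 1) :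
    acceptProb O ((unitaryGate U, false) ::
        List.replicate n (unitaryGate (1 : Matrix.unitaryGroup B ℂ), false)) dec φ =
      sampleExp (fun a => ‖Matrix.mulVec (U : Matrix B B ℂ) φ a‖ ^ 2) (n + 1)
        (fun v => if dec v = true then 1 else 0) := by
  rw [acceptProb_sample_cons _ _ _ _ hφ, sampleExp]
  refine Finset.sum_congr rfl fun a _ => ?_
  rw [acceptProb_replicate_sample]
  rw [normSqSum_mulVec_unitary, hφ]

/-- Every unit vector is the image of a basis state under some unitary. -/
theorem exists_unitary_mulVec_single (e : B) {v : B → ℂ} (hv : normSqSum v = 1) :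
    ∃ U : Matrix.unitaryGroup B ℂ, Matrix.mulVec (U : Matrix B B ℂ) (Pi.single e 1) = v := by
  have hn : ‖WithLp.toLp 2 v‖ = 1 := by
    rw [EuclideanSpace.norm_eq]
    exact (congrArg Real.sqrt hv).trans Real.sqrt_one
  obtain ⟨b, hb⟩ := Orthonormal.exists_orthonormalBasis_extension_of_card_eq (𝕜 := ℂ)
    (E := EuclideanSpace ℂ B) (ι := B) (by simp) (v := fun _ => WithLp.toLp 2 v) (s := {e})
    ⟨fun _ => hn, fun i j hij => absurd (Subsingleton.elim i j) hij⟩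
  refine ⟨⟨_, (EuclideanSpace.basisFun B ℂ).toMatrix_orthonormalBasis_mem_unitary b⟩, ?_⟩
  ext a
  rw [Matrix.mulVec_single_one]
  change (EuclideanSpace.basisFun B ℂ).toBasis.toMatrix b a e = v a
  rw [Module.Basis.toMatrix_apply, hb e rfl]
  simp

end Circuits

/-! ### Products of registers -/

section Registers

variable {R : Type} [Fintype R] {Q : ℕ}

/-- Tensor product of matrices, one for each register. -/
def piMatrix (M : Fin Q → Matrix R R ℂ) : Matrix (Fin Q → R) (Fin Q → R) ℂ :=
  fun r s => ∏ j, M j (r j) (s j)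

theorem piMatrix_mulVec_prod (M : Fin Q → Matrix R R ℂ) (v : Fin Q → R → ℂ) :
    Matrix.mulVec (piMatrix M) (fun w => ∏ j, v j (w j)) =
      fun w => ∏ j, Matrix.mulVec (M j) (v j) (w j) := by
  ext w
  simp only [Matrix.mulVec, dotProduct, piMatrix, ← Finset.prod_mul_distrib]
  exact (Fintype.prod_sum fun j r => M j (w j) r * v j r).symm

theorem piMatrix_mem_unitaryGroup [DecidableEq R] {M : Fin Q → Matrix R R ℂ}
    (hM : ∀ j, M j ∈ Matrix.unitaryGroup R ℂ) :
    piMatrix M ∈ Matrix.unitaryGroup (Fin Q → R) ℂ := by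
  rw [Matrix.mem_unitaryGroup_iff]
  ext r s
  simp only [Matrix.mul_apply, Matrix.star_apply, piMatrix, star_prod,
    ← Finset.prod_mul_distrib]
  rw [← Fintype.prod_sum fun j t => M j (r j) t * star (M j (s j) t)]
  have h : ∀ j, ∑ t, M j (r j) t * star (M j (s j) t) = if r j = s j then 1 else 0 := fun j => by
    have := congrFun (congrFun (Matrix.mem_unitaryGroup_iff.1 (hM j)) (r j)) (s j)
    simpa only [Matrix.mul_apply, Matrix.star_apply, Matrix.one_apply] using this
  simp only [h, Matrix.one_apply, Finset.prod_ite_zero, Finset.prod_const_one, Finset.mem_univ,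
    true_implies, funext_iff]

theorem normSqSum_prod (v : Fin Q → R → ℂ) :
    normSqSum (fun w : Fin Q → R => ∏ j, v j (w j)) = ∏ j, normSqSum (v j) := by
  simp only [normSqSum, norm_prod, ← Finset.prod_pow]
  exact (Fintype.prod_sum fun j r => ‖v j r‖ ^ 2).symm

/-- Marginal distribution of one register of a product state. -/
theorem sum_prod_marginal [DecidableEq R] {p : Fin Q → R → ℝ} (hp : ∀ j, ∑ r, p j r = 1)
    (j : Fin Q) (r : R) :
    ∑ w : Fin Q → R, (if w j = r then ∏ l, p l (w l) else 0) = p j r := by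
  -- Absorb the event on register `j` into the `j`-th factor, so that the sum factorizes and the
  -- other factors sum to 1.
  have h : ∀ w : Fin Q → R, (if w j = r then ∏ l, p l (w l) else 0) =
      ∏ l, (if l = j then if w l = r then p l (w l) else 0 else p l (w l)) := fun w => by
    split_ifs with hw
    · refine Finset.prod_congr rfl fun l _ => ?_
      split_ifs with h1 h2
      · rfl
      · exact absurd (h1 ▸ hw) h2
      · rfl
    · symm
      exact Finset.prod_eq_zero (Finset.mem_univ j) (by simp [hw])
  simp only [h]
  rw [← Fintype.prod_sum fun l s => if l = j then if s = r then p l s else 0 else p l s,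
    Finset.prod_eq_single j]
  · simp
  · intro l _ hl
    simp [hl, hp]
  · simp

end Registers

/-! ### Reading values by a Fourier transform -/

section Fourier

variable {N : ℕ}

/-- The characters of `ℤ / N`. -/
noncomputable def fourierChar (b c : Fin N) : ℂ :=
  Complex.exp (2 * Real.pi * Complex.I / N) ^ ((b : ℕ) * (c : ℕ))

theorem queryPhase_eq_fourierChar (f : Fin N → Fin N) (r : Fin N × Fin N) :
    queryPhase f r = fourierChar r.2 (f r.1) := by
  rw [queryPhase, fourierChar, ← Complex.exp_nat_mul]
  congr 1
  push_cast
  ring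

variable [NeZero N]

/-- A geometric sum whose ratio is an `N`-th root of unity, equal to 1 only for `c = d` because `exp
(2πi / N)` is a primitive root. -/
theorem sum_star_fourierChar_mul (c d : Fin N) :
    ∑ b : Fin N, star (fourierChar b c) * fourierChar b d = if c = d then (N : ℂ) else 0 := by
  have hω := Complex.isPrimitiveRoot_exp N (NeZero.ne N)
  set ω := Complex.exp (2 * Real.pi * Complex.I / N) with hωd
  have hn : star ω * ω = 1 := by
    have h1 : ‖ω‖ = 1 := hω.norm'_eq_one (NeZero.ne N)
    have := Complex.conj_mul' ω
    rw [h1] at this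
    simpa using this
  have hs : ∀ b : Fin N, star (fourierChar b c) * fourierChar b d =
      (star ω ^ (c : ℕ) * ω ^ (d : ℕ)) ^ (b : ℕ) := fun b => by
    simp only [fourierChar, ← hωd, star_pow]
    ring
  simp only [hs]
  rw [Fin.sum_univ_eq_sum_range (fun b => (star ω ^ (c : ℕ) * ω ^ (d : ℕ)) ^ b)]
  split_ifs with h
  · subst h
    rw [← mul_pow, hn]
    simp
  · have hζ : star ω ^ (c : ℕ) * ω ^ (d : ℕ) ≠ 1 := by
      intro h1
      have h2 : ω ^ (d : ℕ) = ω ^ (c : ℕ) := by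
        have h3 : (star ω * ω) ^ (c : ℕ) = 1 := by rw [hn, one_pow]
        rw [mul_pow] at h3
        have h4 : star ω ^ (c : ℕ) ≠ 0 := left_ne_zero_of_mul_eq_one h3
        exact mul_left_cancel₀ h4 (h1.trans h3.symm)
      exact h (Fin.ext (hω.pow_inj c.2 d.2 h2.symm))
    have hζN : (star ω ^ (c : ℕ) * ω ^ (d : ℕ)) ^ N = 1 := by
      rw [mul_pow, ← pow_mul, ← pow_mul, mul_comm (c : ℕ), mul_comm (d : ℕ), pow_mul, pow_mul,
        ← star_pow, hω.pow_eq_one]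
      simp
    have hg := mul_neg_geom_sum (star ω ^ (c : ℕ) * ω ^ (d : ℕ)) N
    rw [hζN, sub_self] at hg
    exact (mul_eq_zero.1 hg).resolve_left (sub_ne_zero.2 hζ.symm)

/-- The inverse Fourier transform of the second half of a query register. -/
noncomputable def inverseFourier (N : ℕ) : Matrix (Fin N × Fin N) (Fin N × Fin N) ℂ :=
  fun r s => if r.1 = s.1 then ((√(N : ℝ) : ℝ) : ℂ)⁻¹ * star (fourierChar s.2 r.2) else 0

theorem inverseFourier_mem_unitaryGroup :
    inverseFourier N ∈ Matrix.unitaryGroup (Fin N × Fin N) ℂ := by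
  have hN : (N : ℂ) ≠ 0 := by exact_mod_cast NeZero.ne N
  have hsq : ((√(N : ℝ) : ℝ) : ℂ)⁻¹ * ((√(N : ℝ) : ℝ) : ℂ)⁻¹ = (N : ℂ)⁻¹ := by
    rw [← mul_inv, ← Complex.ofReal_mul, Real.mul_self_sqrt (by positivity)]
    simp
  rw [Matrix.mem_unitaryGroup_iff]
  ext r s
  rw [Matrix.mul_apply, Fintype.sum_prod_type, Finset.sum_eq_single r.1]
  · simp only [Matrix.star_apply, inverseFourier, if_true]
    by_cases h : s.1 = r.1
    · have : ∀ b : Fin N, ((√(N : ℝ) : ℝ) : ℂ)⁻¹ * star (fourierChar b r.2) *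
          star (((√(N : ℝ) : ℝ) : ℂ)⁻¹ * star (fourierChar b s.2)) =
          (N : ℂ)⁻¹ * (star (fourierChar b r.2) * fourierChar b s.2) := fun b => by
        rw [star_mul', star_star, ← hsq]
        simp only [star_inv₀, Complex.star_def, Complex.conj_ofReal]
        ring
      simp only [h, if_true, this, ← Finset.mul_sum, sum_star_fourierChar_mul, Matrix.one_apply,
        Prod.ext_iff, true_and]
      split_ifs <;> simp [hN]
    · have h' : ¬ r = s := fun e => h (by rw [e])
      simp [h, h']
  · intro i _ hi
    simp [inverseFourier, hi.symm]
  · simp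

/-- Uniform superposition of the positions in `S`, ready for a query. -/
noncomputable def blockState (S : Finset (Fin N)) (r : Fin N × Fin N) : ℂ :=
  if r.1 ∈ S then ((√((S.card : ℝ) * N) : ℝ) : ℂ)⁻¹ else 0

theorem normSqSum_blockState {S : Finset (Fin N)} (hS : S.Nonempty) :
    normSqSum (blockState S) = 1 := by
  have hc : (0 : ℝ) < S.card := by exact_mod_cast hS.card_pos
  have hN : (0 : ℝ) < N := by exact_mod_cast NeZero.pos N
  have h : ∀ r : Fin N × Fin N,
      ‖blockState S r‖ ^ 2 = if r.1 ∈ S then ((S.card : ℝ) * N)⁻¹ else 0 := fun r => by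
    unfold blockState
    split_ifs
    · rw [norm_inv, Complex.norm_real, Real.norm_of_nonneg (Real.sqrt_nonneg _), inv_pow,
        Real.sq_sqrt (by positivity)]
    · simp
  simp only [normSqSum, h]
  rw [Fintype.sum_prod_type, Finset.sum_comm]
  simp only [Finset.sum_ite_mem, Finset.univ_inter, Finset.sum_const, Finset.card_univ,
    Fintype.card_fin, nsmul_eq_mul]
  field_simp

/-- The query turns the uniform `b`-register into the character of `f i`, and the inverse transform
maps it to the basis state `f i`. -/
theorem norm_sq_inverseFourier_mulVec (S : Finset (Fin N)) (f : Fin N → Fin N)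
    (r : Fin N × Fin N) :
    ‖Matrix.mulVec (inverseFourier N) (fun s => queryPhase f s * blockState S s) r‖ ^ 2 =
      if r.1 ∈ S ∧ r.2 = f r.1 then (S.card : ℝ)⁻¹ else 0 := by
  have hN : (0 : ℝ) < N := by exact_mod_cast NeZero.pos N
  have hN' : (N : ℂ) ≠ 0 := by exact_mod_cast NeZero.ne N
  have h : Matrix.mulVec (inverseFourier N) (fun s => queryPhase f s * blockState S s) r =
      if r.1 ∈ S ∧ r.2 = f r.1 then ((√(N : ℝ) : ℝ) : ℂ)⁻¹ *
        ((√((S.card : ℝ) * N) : ℝ) : ℂ)⁻¹ * N else 0 := by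
    rw [Matrix.mulVec, dotProduct, Fintype.sum_prod_type, Finset.sum_eq_single r.1]
    · simp only [inverseFourier, if_true, queryPhase_eq_fourierChar, blockState]
      by_cases hS : r.1 ∈ S
      · have e : ∀ b : Fin N, ((√(N : ℝ) : ℝ) : ℂ)⁻¹ * star (fourierChar b r.2) *
            (fourierChar b (f r.1) * ((√((S.card : ℝ) * N) : ℝ) : ℂ)⁻¹) =
            ((√(N : ℝ) : ℝ) : ℂ)⁻¹ * ((√((S.card : ℝ) * N) : ℝ) : ℂ)⁻¹ *
              (star (fourierChar b r.2) * fourierChar b (f r.1)) := fun b => by ring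
        simp only [hS, if_true, e, ← Finset.mul_sum, sum_star_fourierChar_mul, true_and]
        split_ifs <;> simp
      · simp [hS]
    · intro i _ hi
      simp [inverseFourier, hi.symm]
    · simp
  rw [h]
  split_ifs with hr
  · have hc : (0 : ℝ) < S.card := by exact_mod_cast Finset.card_pos.2 ⟨_, hr.1⟩
    rw [norm_mul, norm_mul, norm_inv, norm_inv, Complex.norm_real, Complex.norm_real,
      Real.norm_of_nonneg (Real.sqrt_nonneg _), Real.norm_of_nonneg (Real.sqrt_nonneg _),
      Complex.norm_natCast, mul_pow, mul_pow, inv_pow, inv_pow, Real.sq_sqrt hN.le,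
      Real.sq_sqrt (by positivity)]
    field_simp
  · simp

end Fourier

/-! ### Upper bounds -/

section UpperBounds

variable {N Q : ℕ}

/-- Distribution of the samples of the registers after the queries and the Fourier transform. -/
noncomputable def readDist (S : Fin Q → Finset (Fin N)) (f : Fin N → Fin N)
    (w : Fin Q → Fin N × Fin N) : ℝ :=
  ∏ j, if (w j).1 ∈ S j ∧ (w j).2 = f (w j).1 then ((S j).card : ℝ)⁻¹ else 0

theorem readDist_supp {S : Fin Q → Finset (Fin N)} {f : Fin N → Fin N}
    {w : Fin Q → Fin N × Fin N} (h : readDist S f w ≠ 0) (j : Fin Q) : (w j).2 = f (w j).1 := by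
  by_contra hj
  exact h (Finset.prod_eq_zero (Finset.mem_univ j) (by simp [hj]))

variable [NeZero N]

/-- Product state in which register `j` is the uniform superposition of the block `S j`. -/
noncomputable def blocksState (S : Fin Q → Finset (Fin N)) (w : Fin Q → Fin N × Fin N) : ℂ :=
  ∏ j, blockState (S j) (w j)

/-- The inverse Fourier transform on all registers. -/
noncomputable def inverseFourierAll (N Q : ℕ) [NeZero N] :
    Matrix.unitaryGroup (Fin Q → Fin N × Fin N) ℂ :=
  ⟨piMatrix fun _ => inverseFourier N,
    piMatrix_mem_unitaryGroup fun _ => inverseFourier_mem_unitaryGroup⟩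

theorem normSqSum_blocksState {S : Fin Q → Finset (Fin N)} (hS : ∀ j, (S j).Nonempty) :
    normSqSum (blocksState S) = 1 := by
  unfold blocksState
  rw [normSqSum_prod]
  exact Finset.prod_eq_one fun j _ => normSqSum_blockState (hS j)

theorem norm_sq_inverseFourierAll_mulVec (S : Fin Q → Finset (Fin N)) (f : Fin N → Fin N)
    (w : Fin Q → Fin N × Fin N) :
    ‖Matrix.mulVec (inverseFourierAll N Q).1
      (fun w => (∏ j, queryPhase f (w j)) * blocksState S w) w‖ ^ 2 = readDist S f w := by
  simp only [blocksState, ← Finset.prod_mul_distrib, inverseFourierAll]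
  rw [piMatrix_mulVec_prod (fun _ => inverseFourier N)
    (fun j r => queryPhase f r * blockState (S j) r), norm_prod, ← Finset.prod_pow]
  simp only [norm_sq_inverseFourier_mulVec, readDist]

theorem readDist_hit {S : Fin Q → Finset (Fin N)} (hS : ∀ j, (S j).Nonempty) (f : Fin N → Fin N)
    {x : Fin N} {j : Fin Q} (hx : x ∈ S j) :
    ∑ w, (if w j = (x, f x) then readDist S f w else 0) = ((S j).card : ℝ)⁻¹ := by
  unfold readDist
  rw [sum_prod_marginal (p := fun j r => if r.1 ∈ S j ∧ r.2 = f r.1 then ((S j).card : ℝ)⁻¹ else 0)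
    (fun j => ?_) j (x, f x)]
  · simp [hx]
  · simp only [← norm_sq_inverseFourier_mulVec]
    have h1 := normSqSum_mulVec_unitary ⟨_, inverseFourier_mem_unitaryGroup (N := N)⟩
      (fun s => queryPhase f s * blockState (S j) s)
    rwa [normSqSum_phase (norm_queryPhase f), normSqSum_blockState (hS j)] at h1

/-- Circuits that end with the registers in the state prepared by the queries, read by `read`,
decide distinctness. -/
theorem samples_decide {B : Type} [Fintype B] [DecidableEq B] (O : B → ℂ)
    (read : B → Fin Q → Fin N × Fin N)
    (U : Matrix.unitaryGroup B ℂ) {φ : B → ℂ} (hφ : normSqSum φ = 1)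
    {S : Fin Q → Finset (Fin N)} (hS : ∀ j, (S j).Nonempty) {K n : ℕ} (hK : ∀ j, (S j).card ≤ K)
    (hcover : ∀ x, ∃ j, x ∈ S j) (hn : 2 * K ≤ n + 1) (f : Fin N → Fin N)
    (hsum : ∀ F : (Fin Q → Fin N × Fin N) → ℝ,
      ∑ a, F (read a) * ‖Matrix.mulVec (U : Matrix B B ℂ) φ a‖ ^ 2 = ∑ w, F w * readDist S f w) :
    (HasCollision f → 2 / 3 ≤ acceptProb O ((unitaryGate U, false) ::
      List.replicate n (unitaryGate 1, false)) (collisionSeen read) φ) ∧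
    (¬ HasCollision f → acceptProb O ((unitaryGate U, false) ::
      List.replicate n (unitaryGate 1, false)) (collisionSeen read) φ ≤ 1 / 3) := by
  classical
  have hpos : ∀ j, 0 < (S j).card := fun j => (hS j).card_pos
  rw [acceptProb_unitary_samples _ _ _ _ hφ]
  refine collisionSeen_decides (fun a => by positivity) ?_ (K := K) ?_ hn read f ?_ ?_
  · exact (normSqSum_mulVec_unitary U φ).trans hφ
  · obtain ⟨j, -⟩ := hcover 0
    exact (hpos j).trans_le (hK j)
  · intro a ha j
    by_contra hj
    -- Test the law of `read` on the indicator of a misread register: it has expectation 0, so no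
    -- basis state of positive weight is misread.
    have h1 := hsum fun w => if (w j).2 = f (w j).1 then 0 else 1
    rw [Finset.sum_eq_zero (s := Finset.univ) (f := fun w => _ * readDist S f w)] at h1
    · have h2 := (Finset.sum_eq_zero_iff_of_nonneg (fun a _ => ?_)).1 h1 a (Finset.mem_univ a)
      · simp [hj] at h2
        exact ha (by simp [h2])
      · split_ifs <;> positivity
    · intro w _
      split_ifs with h
      · simp
      · by_contra h0
        exact h (readDist_supp (right_ne_zero_of_mul h0) j)
  · intro x
    obtain ⟨j, hj⟩ := hcover x
    refine ⟨j, ?_⟩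
    have h1 := hsum fun w => if w j = (x, f x) then 1 else 0
    simp only [ite_mul, one_mul, zero_mul] at h1
    rw [h1, readDist_hit hS f hj]
    exact inv_anti₀ (by exact_mod_cast hpos j) (by exact_mod_cast hK j)

/-- Blocks of about `√N` consecutive positions, with `0` added to each. -/
def blocks (N : ℕ) [NeZero N] (j : Fin (Nat.sqrt N + 1)) : Finset (Fin N) :=
  insert 0 (Finset.univ.filter fun i : Fin N => (i : ℕ) / (Nat.sqrt N + 1) = j)

theorem card_blocks_le (j : Fin (Nat.sqrt N + 1)) : (blocks N j).card ≤ Nat.sqrt N + 2 := by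
  refine (Finset.card_insert_le _ _).trans (Nat.succ_le_succ ?_)
  refine (Finset.card_le_card_of_injOn (t := Finset.range (Nat.sqrt N + 1))
    (fun i : Fin N => (i : ℕ) % (Nat.sqrt N + 1)) (fun i _ => ?_) fun i hi k hk h => ?_).trans
    (by simp)
  · simpa using Nat.mod_lt _ (Nat.succ_pos _)
  · simp only [Finset.coe_filter, Finset.mem_univ, true_and, Set.mem_ofPred_eq] at hi hk
    have h' : (i : ℕ) % (Nat.sqrt N + 1) = (k : ℕ) % (Nat.sqrt N + 1) := h
    exact Fin.ext (by
      rw [← Nat.div_add_mod (i : ℕ) (Nat.sqrt N + 1), ← Nat.div_add_mod (k : ℕ) (Nat.sqrt N + 1),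
        hi, hk, h'])

theorem blocks_cover (x : Fin N) : ∃ j, x ∈ blocks N j := by
  refine ⟨⟨(x : ℕ) / (Nat.sqrt N + 1), ?_⟩, by simp [blocks]⟩
  exact Nat.div_lt_of_lt_mul (x.2.trans (Nat.lt_succ_sqrt N))

/-- This is what the extra position 0 is for: a block of quotients may be empty, and then its
superposition would not be a unit vector. -/
theorem blocks_nonempty (j : Fin (Nat.sqrt N + 1)) : (blocks N j).Nonempty :=
  Finset.insert_nonempty _ _

theorem one_le_sqrt_natCast : (1 : ℝ) ≤ √(N : ℝ) :=
  Real.one_le_sqrt.2 (by exact_mod_cast NeZero.one_le)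

/-! ### The non-adaptive algorithm -/

/-- The query registers in the state `ψ` next to a trivial workspace. -/
def withUnit {W : Type} (ψ : W → ℂ) (a : W × Unit) : ℂ := ψ a.1

theorem normSqSum_withUnit {W : Type} [Fintype W] (ψ : W → ℂ) :
    normSqSum (withUnit ψ) = normSqSum ψ := by
  simp [normSqSum, withUnit, Fintype.sum_prod_type]

/-- The inverse Fourier transform on all registers, next to a trivial workspace. -/
noncomputable def inverseFourierUnit (N Q : ℕ) [NeZero N] :
    Matrix.unitaryGroup ((Fin Q → Fin N × Fin N) × Unit) ℂ :=
  ⟨_, Matrix.kronecker_mem_unitary (inverseFourierAll N Q).2 (1 : Matrix.unitaryGroup Unit ℂ).2⟩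

theorem inverseFourierUnit_mulVec (φ : (Fin Q → Fin N × Fin N) → ℂ) :
    Matrix.mulVec (inverseFourierUnit N Q).1 (withUnit φ) =
      withUnit (Matrix.mulVec (inverseFourierAll N Q).1 φ) := by
  ext a
  simp [Matrix.mulVec, dotProduct, Fintype.sum_prod_type, inverseFourierUnit,
    Matrix.kroneckerMap_apply, withUnit]

/-- Query all the registers after the unitary `U₀`, read the values by an inverse Fourier
transform, and look for a collision in `n + 1` samples. -/
noncomputable def NonadaptivePDQPAlgorithm.collisionFinder
    (U₀ : Matrix.unitaryGroup ((Fin Q → Fin N × Fin N) × Unit) ℂ) (n : ℕ) :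
    NonadaptivePDQPAlgorithm N where
  queries := Q
  W := Unit
  Out := Unit
  init := (0, ())
  U₀ := U₀
  steps := unitaryGate (inverseFourierUnit N Q) :: List.replicate n (unitaryGate 1)
  dec := collisionSeen Prod.fst

theorem NonadaptivePDQPAlgorithm.collisionFinder_samples
    (U₀ : Matrix.unitaryGroup ((Fin Q → Fin N × Fin N) × Unit) ℂ) (n : ℕ) :
    (collisionFinder U₀ n).samples = n + 1 := by
  change (unitaryGate (inverseFourierUnit N Q) :: List.replicate n (unitaryGate 1)).length = n + 1
  rw [List.length_cons, List.length_replicate]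

theorem NonadaptivePDQPAlgorithm.collisionFinder_accept
    (U₀ : Matrix.unitaryGroup ((Fin Q → Fin N × Fin N) × Unit) ℂ) (n : ℕ) (f : Fin N → Fin N) :
    (collisionFinder U₀ n).accept f =
      acceptProb (fun a : (Fin Q → Fin N × Fin N) × Unit => ∏ j, queryPhase f (a.1 j))
        ((unitaryGate (inverseFourierUnit N Q) :: List.replicate n (unitaryGate 1)).map
          fun g => (g, false)) (collisionSeen Prod.fst)
        fun a => (∏ j, queryPhase f (a.1 j)) * Matrix.mulVec U₀.1 (Pi.single (0, ()) 1) a :=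
  rfl

theorem NonadaptivePDQPAlgorithm.collisionFinder_decides
    {U₀ : Matrix.unitaryGroup ((Fin Q → Fin N × Fin N) × Unit) ℂ}
    {S : Fin Q → Finset (Fin N)} (hU₀ : Matrix.mulVec U₀.1 (Pi.single (0, ()) 1) =
      withUnit (blocksState S)) (hS : ∀ j, (S j).Nonempty) {K n : ℕ} (hK : ∀ j, (S j).card ≤ K)
    (hcover : ∀ x, ∃ j, x ∈ S j) (hn : 2 * K ≤ n + 1) :
    DecidesDistinctnessOn Set.univ (collisionFinder U₀ n).accept := by
  intro f _
  have hφ' : (fun a : (Fin Q → Fin N × Fin N) × Unit => (∏ j, queryPhase f (a.1 j)) *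
      withUnit (blocksState S) a) =
      withUnit fun w => (∏ j, queryPhase f (w j)) * blocksState S w := rfl
  rw [collisionFinder_accept, hU₀, List.map_cons, List.map_replicate, hφ']
  have hφ : normSqSum (fun w => (∏ j, queryPhase f (w j)) * blocksState S w) = 1 := by
    rw [normSqSum_phase (norm_prod_queryPhase f), normSqSum_blocksState hS]
  refine samples_decide _ Prod.fst _ (by rw [normSqSum_withUnit, hφ]) hS hK hcover hn f
    fun F => ?_
  rw [inverseFourierUnit_mulVec, Fintype.sum_prod_type]
  simp only [withUnit, norm_sq_inverseFourierAll_mulVec, Finset.univ_unique, Finset.sum_singleton]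

theorem NonadaptivePDQPAlgorithm.upper_bound :
    ∃ A : NonadaptivePDQPAlgorithm N, DecidesDistinctnessOn Set.univ A.accept ∧
      (A.queries : ℝ) + (A.samples : ℝ) ≤ 9 * √(N : ℝ) := by
  obtain ⟨U₀, hU₀⟩ := exists_unitary_mulVec_single
    ((0 : Fin (Nat.sqrt N + 1) → Fin N × Fin N), ()) (v := withUnit (blocksState (blocks N)))
    (by rw [normSqSum_withUnit, normSqSum_blocksState blocks_nonempty])
  refine ⟨collisionFinder U₀ (2 * (Nat.sqrt N + 2)), collisionFinder_decides hU₀ blocks_nonempty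
    card_blocks_le blocks_cover (by omega), ?_⟩
  rw [collisionFinder_samples, show
    (collisionFinder U₀ (2 * (Nat.sqrt N + 2))).queries = Nat.sqrt N + 1 from rfl]
  have h2 := Real.nat_sqrt_le_real_sqrt (a := N)
  have h3 := one_le_sqrt_natCast (N := N)
  push_cast
  linarith

/-! ### The adaptive algorithm -/

/-- Exchange the query register with register `j` of the workspace. -/
def swapRegister {R : Type} (j : Fin Q) : Equiv.Perm (R × (Fin Q → R)) where
  toFun a := (a.2 j, Function.update a.2 j a.1)
  invFun a := (a.2 j, Function.update a.2 j a.1)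
  left_inv a := by simp
  right_inv a := by simp

theorem permMatrix_mem_unitaryGroup {B : Type} [Fintype B] [DecidableEq B] (σ : Equiv.Perm B) :
    σ.permMatrix ℂ ∈ Matrix.unitaryGroup B ℂ := by
  rw [Matrix.mem_unitaryGroup_iff, Matrix.star_eq_conjTranspose, Matrix.conjTranspose_permMatrix,
    ← Matrix.permMatrix_mul, inv_mul_cancel, Matrix.permMatrix_one]

/-- The gate that exchanges the query register with register `j` of the workspace. -/
noncomputable def swapGate {R : Type} [Fintype R] [DecidableEq R] (j : Fin Q) :
    Gate (R × (Fin Q → R)) Unit :=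
  unitaryGate ⟨_, permMatrix_mem_unitaryGroup (swapRegister j)⟩

/-- The query register in a basis state next to a workspace in the state `ψ`. -/
def withQueryRegister {R W : Type} [DecidableEq R] (r₀ : R) (ψ : W → ℂ) (a : R × W) : ℂ :=
  if a.1 = r₀ then ψ a.2 else 0

theorem normSqSum_withQueryRegister {R W : Type} [Fintype R] [Fintype W] [DecidableEq R] (r₀ : R)
    (ψ : W → ℂ) : normSqSum (withQueryRegister r₀ ψ) = normSqSum ψ := by
  unfold normSqSum withQueryRegister
  rw [Fintype.sum_prod_type, Finset.sum_eq_single r₀] <;> simp +contextual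

/-- Swapping register `j` in, querying, and swapping it back amounts to a query on register `j`;
the query after the second swap has no effect. -/
theorem acceptProb_swap_query {R : Type} [Fintype R] [DecidableEq R] {χ : R → ℂ}
    (hχ : ∀ r, ‖χ r‖ = 1) {r₀ : R} (hr₀ : χ r₀ = 1) (j : Fin Q)
    (rest : List (Gate (R × (Fin Q → R)) Unit × Bool)) (dec : List (R × (Fin Q → R)) → Bool)
    {ψ : (Fin Q → R) → ℂ} (hψ : normSqSum ψ = 1) :
    acceptProb (fun a => χ a.1) ((swapGate j, true) :: (swapGate j, true) :: rest) dec
      (withQueryRegister r₀ ψ) =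
    acceptProb (fun a => χ a.1) rest dec (withQueryRegister r₀ fun w => χ (w j) * ψ w) := by
  have h0 : normSqSum (withQueryRegister r₀ ψ) = 1 := by rw [normSqSum_withQueryRegister, hψ]
  rw [swapGate, acceptProb_query_cons _ _ _ _ h0, acceptProb_query_cons]
  · congr 1
    ext ⟨r, w⟩
    simp only [Matrix.permMatrix_mulVec, Function.comp_apply, swapRegister, Equiv.coe_fn_mk,
      withQueryRegister, Function.update_self, Function.update_idem, Function.update_eq_self]
    split_ifs with h
    · rw [h, hr₀, one_mul]
    · simp
  · rw [normSqSum_phase (O := fun a : R × (Fin Q → R) => χ a.1) (fun a => hχ a.1),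
      normSqSum_mulVec_unitary, h0]

theorem acceptProb_swap_queries {R : Type} [Fintype R] [DecidableEq R] {χ : R → ℂ}
    (hχ : ∀ r, ‖χ r‖ = 1) {r₀ : R} (hr₀ : χ r₀ = 1) (l : List (Fin Q))
    (rest : List (Gate (R × (Fin Q → R)) Unit × Bool)) (dec : List (R × (Fin Q → R)) → Bool)
    {ψ : (Fin Q → R) → ℂ} (hψ : normSqSum ψ = 1) :
    acceptProb (fun a => χ a.1)
      (l.flatMap (fun j => [(swapGate j, true), (swapGate j, true)]) ++ rest) dec
      (withQueryRegister r₀ ψ) =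
    acceptProb (fun a => χ a.1) rest dec
      (withQueryRegister r₀ fun w => (l.map fun j => χ (w j)).prod * ψ w) := by
  induction l generalizing ψ with
  | nil => simp
  | cons j l ih =>
    rw [List.flatMap_cons, List.append_assoc, List.cons_append, List.cons_append, List.nil_append,
      acceptProb_swap_query hχ hr₀ j _ _ hψ, ih]
    · congr 2
      ext w
      rw [List.map_cons, List.prod_cons]
      ring
    · rw [normSqSum_phase (O := fun w : Fin Q → R => χ (w j)) (fun w => hχ _), hψ]

/-- The inverse Fourier transform on all the registers of the workspace. -/
noncomputable def inverseFourierWork (N Q : ℕ) [NeZero N] :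
    Matrix.unitaryGroup ((Fin N × Fin N) × (Fin Q → Fin N × Fin N)) ℂ :=
  ⟨_, Matrix.kronecker_mem_unitary (1 : Matrix.unitaryGroup (Fin N × Fin N) ℂ).2
    (inverseFourierAll N Q).2⟩

theorem inverseFourierWork_mulVec (r₀ : Fin N × Fin N) (φ : (Fin Q → Fin N × Fin N) → ℂ) :
    Matrix.mulVec (inverseFourierWork N Q).1 (withQueryRegister r₀ φ) =
      withQueryRegister r₀ (Matrix.mulVec (inverseFourierAll N Q).1 φ) := by
  ext ⟨r, w⟩
  rw [Matrix.mulVec, dotProduct, Fintype.sum_prod_type, Finset.sum_eq_single r]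
  · by_cases hr : r = r₀ <;>
      simp [hr, inverseFourierWork, Matrix.kroneckerMap_apply, withQueryRegister, Matrix.mulVec,
        dotProduct]
  · intro s _ hs
    simp [inverseFourierWork, Matrix.kroneckerMap_apply, Matrix.one_apply_ne hs.symm]
  · simp

/-- Query the registers of the workspace one after the other after the unitary `U₀`, read the
values by an inverse Fourier transform, and look for a collision in `n + 1` samples. -/
noncomputable def PDQPAlgorithm.collisionFinder
    (U₀ : Matrix.unitaryGroup ((Fin N × Fin N) × (Fin Q → Fin N × Fin N)) ℂ) (n : ℕ) :
    PDQPAlgorithm N where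
  W := Fin Q → Fin N × Fin N
  Out := Unit
  init := (0, 0)
  steps := (unitaryGate U₀, true) ::
    ((List.finRange Q).flatMap (fun j => [(swapGate j, true), (swapGate j, true)]) ++
      (unitaryGate (inverseFourierWork N Q), false) ::
        List.replicate n (unitaryGate 1, false))
  dec := collisionSeen Prod.snd

theorem PDQPAlgorithm.collisionFinder_complexity
    (U₀ : Matrix.unitaryGroup ((Fin N × Fin N) × (Fin Q → Fin N × Fin N)) ℂ) (n : ℕ) :
    (collisionFinder U₀ n).queries + (collisionFinder U₀ n).samples = 2 * Q + n + 2 := by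
  have h : (collisionFinder U₀ n).queries + (collisionFinder U₀ n).samples =
      (collisionFinder U₀ n).steps.length := by
    rw [List.length_eq_countP_add_countP (fun s => s.2)]
    simp [queries, samples]
  rw [h]
  change ((unitaryGate U₀, true) ::
    ((List.finRange Q).flatMap (fun j => [(swapGate j, true), (swapGate j, true)]) ++
      (unitaryGate (inverseFourierWork N Q), false) ::
        List.replicate n (unitaryGate 1, false))).length = 2 * Q + n + 2
  simp only [List.length_cons, List.length_append, List.length_flatMap,
    List.length_replicate, List.length_nil, List.map_const', List.length_finRange,
    List.sum_replicate, smul_eq_mul]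
  ring

theorem PDQPAlgorithm.collisionFinder_accept
    (U₀ : Matrix.unitaryGroup ((Fin N × Fin N) × (Fin Q → Fin N × Fin N)) ℂ) (n : ℕ)
    (f : Fin N → Fin N) :
    (collisionFinder U₀ n).accept f =
      acceptProb (fun a : (Fin N × Fin N) × (Fin Q → Fin N × Fin N) => queryPhase f a.1)
        ((unitaryGate U₀, true) ::
          ((List.finRange Q).flatMap (fun j => [(swapGate j, true), (swapGate j, true)]) ++
            (unitaryGate (inverseFourierWork N Q), false) ::
              List.replicate n (unitaryGate 1, false))) (collisionSeen Prod.snd)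
        (Pi.single (0, 0) 1) :=
  rfl

theorem PDQPAlgorithm.collisionFinder_decides
    {U₀ : Matrix.unitaryGroup ((Fin N × Fin N) × (Fin Q → Fin N × Fin N)) ℂ}
    {S : Fin Q → Finset (Fin N)} (hU₀ : Matrix.mulVec U₀.1 (Pi.single (0, 0) 1) =
      withQueryRegister 0 (blocksState S)) (hS : ∀ j, (S j).Nonempty) {K n : ℕ}
    (hK : ∀ j, (S j).card ≤ K) (hcover : ∀ x, ∃ j, x ∈ S j) (hn : 2 * K ≤ n + 1) :
    DecidesDistinctnessOn Set.univ (collisionFinder U₀ n).accept := by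
  intro f _
  have h0 : queryPhase f 0 = 1 := by simp [queryPhase]
  have hacc : (collisionFinder U₀ n).accept f =
      acceptProb (fun a : (Fin N × Fin N) × (Fin Q → Fin N × Fin N) => queryPhase f a.1)
        ((unitaryGate (inverseFourierWork N Q), false) ::
          List.replicate n (unitaryGate 1, false)) (collisionSeen Prod.snd)
        (withQueryRegister 0 fun w => (∏ j, queryPhase f (w j)) * blocksState S w) := by
    -- The query attached to the state preparation acts on `b = 0` and has phase 1.
    have h1 : (fun a : (Fin N × Fin N) × (Fin Q → Fin N × Fin N) => queryPhase f a.1 *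
        withQueryRegister 0 (blocksState S) a) = withQueryRegister 0 (blocksState S) := by
      ext a
      unfold withQueryRegister
      split_ifs with h
      · rw [h, h0, one_mul]
      · simp
    rw [collisionFinder_accept, acceptProb_query_cons _ _ _ _ (normSqSum_single _), hU₀, h1,
      acceptProb_swap_queries (norm_queryPhase f) h0 _ _ _ (normSqSum_blocksState hS)]
    simp only [Fin.prod_univ_def]
  rw [hacc]
  have hφ : normSqSum (fun w => (∏ j, queryPhase f (w j)) * blocksState S w) = 1 := by
    rw [normSqSum_phase (norm_prod_queryPhase f), normSqSum_blocksState hS]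
  refine samples_decide _ Prod.snd _ (by rw [normSqSum_withQueryRegister, hφ]) hS hK hcover hn f
    fun F => ?_
  rw [inverseFourierWork_mulVec, Fintype.sum_prod_type, Finset.sum_eq_single 0]
  · simp only [withQueryRegister, if_true, norm_sq_inverseFourierAll_mulVec]
  · intro r _ hr
    simp [withQueryRegister, hr]
  · simp

theorem PDQPAlgorithm.upper_bound :
    ∃ A : PDQPAlgorithm N, DecidesDistinctnessOn Set.univ A.accept ∧
      (A.queries : ℝ) + (A.samples : ℝ) ≤ 12 * √(N : ℝ) := by
  obtain ⟨U₀, hU₀⟩ := exists_unitary_mulVec_single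
    ((0 : Fin N × Fin N), (0 : Fin (Nat.sqrt N + 1) → Fin N × Fin N))
    (v := withQueryRegister 0 (blocksState (blocks N)))
    (by rw [normSqSum_withQueryRegister, normSqSum_blocksState blocks_nonempty])
  refine ⟨collisionFinder U₀ (2 * (Nat.sqrt N + 2)), collisionFinder_decides hU₀ blocks_nonempty
    card_blocks_le blocks_cover (by omega), ?_⟩
  have h1 := collisionFinder_complexity U₀ (2 * (Nat.sqrt N + 2))
  have h2 := Real.nat_sqrt_le_real_sqrt (a := N)
  have h3 := one_le_sqrt_natCast (N := N)
  rw [← Nat.cast_add, h1]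
  push_cast
  linarith

end UpperBounds

theorem mainTheorem9 :
    -- adaptive queries, lower bound
    (∃ c : ℝ, 0 < c ∧ ∀ N : ℕ, 2 ≤ N → ∀ A : PDQPAlgorithm N,
      DecidesDistinctnessOn {f | Function.Injective f ∨ AlmostInjective f} A.accept →
        c * (N : ℝ) ^ (1 / 4 : ℝ) ≤ (A.queries : ℝ) + (A.samples : ℝ)) ∧
    -- adaptive queries, upper bound
    (∃ C : ℝ, ∀ N : ℕ, 1 ≤ N → ∃ A : PDQPAlgorithm N,
      DecidesDistinctnessOn Set.univ A.accept ∧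
        (A.queries : ℝ) + (A.samples : ℝ) ≤ C * Real.sqrt N) ∧
    -- non-adaptive queries, lower bound
    (∃ c : ℝ, 0 < c ∧ ∀ N : ℕ, 2 ≤ N → ∀ A : NonadaptivePDQPAlgorithm N,
      DecidesDistinctnessOn {f | Function.Injective f ∨ AlmostInjective f} A.accept →
        c * Real.sqrt N ≤ (A.queries : ℝ) + (A.samples : ℝ)) ∧
    -- non-adaptive queries, upper bound up to logarithmic factors
    (∃ (C : ℝ) (k : ℕ), ∀ N : ℕ, 2 ≤ N → ∃ A : NonadaptivePDQPAlgorithm N,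
      DecidesDistinctnessOn Set.univ A.accept ∧
        (A.queries : ℝ) + (A.samples : ℝ) ≤ C * (Real.sqrt N * Real.log N ^ k)) := by
  -- The exponent `k = 0` suffices: the non-adaptive algorithm has no logarithmic loss.
  refine ⟨⟨1 / 6, by norm_num, fun N hN A h => A.lower_bound hN h⟩, ⟨12, fun N hN => ?_⟩,
    ⟨1 / 12, by norm_num, fun N hN A h => A.lower_bound hN h⟩, ⟨9, 0, fun N hN => ?_⟩⟩
  · have : NeZero N := ⟨by omega⟩
    exact PDQPAlgorithm.upper_bound
  · have : NeZero N := ⟨by omega⟩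
    simpa using NonadaptivePDQPAlgorithm.upper_bound (N := N)
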